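/- **Setting.** Let $G=(V,E;w,p;r)$ be a finite connected simple undirected graph with root $r$, edge lengths $w_e\ge 0$ and edge profits $p_e\ge 0$. *Preprocessing.* For every vertex $v$ such that $v=r$ or $v$ is incident to at least two positive-profit edges, create one copy of $v$ for each positive-profit edge at $v$, attach that edge to its copy instead of $v$, and join each copy to $v$ by an edge of length $0$ and profit $0$. Let $G'$ be the resulting graph and $\hat V$ its vertex set. Let $\hat G=(\hat V,\hat E;\hat w,\hat p;r)$ be the complete graph on $\hat V$ in which the positive-profit edges (their set is $\hat E^+$) keep their lengths and profits, and every other edge $uv$ has profit $0$ and length $\hat w_{uv}$ equal to the length of a shortest $u$–$v$ path in $G'$. *Linear program.* Write $x(F)=\sum_{e\in F}x_e$, and let $\delta(S)$ be the set of edges with exactly one endpoint in $S$. PCRPP-LP on $\hat G$ minimizes $\sum_{e\in\hat E}\hat w_e x_e+\sum_{e\in\hat E}\hat p_e(1-x_e)$ subject to $x(\delta(v))=2y_v$ and $0\le y_v\le 1$ for $v\in\hat V\setminus\{r\}$; $x(\delta(r))\le 2$; $x(\delta(S))\ge 2y_v$ for $v\in S\subseteq\hat V\setminus\{r\}$; $y_u=y_v=x_{uv}$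 for $uv\in\hat E^+$; $y_r=1$; $0\le x_e\le 1$ for $e\in\hat E^+$; and $x_e\ge 0$ for $e\in\hat E\setminus\hat E^+$. *Splitting.* A splitting-off operation at $v$ either decreases $x_{va}$ and $x_{vb}$ by $\varepsilon$ and increases $x_{ab}$ by $\varepsilon$ (where $a\ne b$ are both different from $v$ and $0<\varepsilon\le\min\{x_{va},x_{vb}\}$), or decreases $x_{va}$ by $\varepsilon$ (where $a\neq v$ and $0<\varepsilon\le x_{va}$). It is feasible if for no two distinct vertices $s,t\ne v$ the minimum $s$–$t$ cut size with respect to $x$ decreases. A complete splitting at $v$ is a sequence of feasible splitting-off operations at $v$ after which $x_e=0$ for all $e\in\delta(v)$. Let $(x^*,y^*)$ be an optimal solution of PCRPP-LP and let $\delta\in[0,1]$. Let $(\tilde x,\tilde y)$ be obtained from $(x^*,y^*)$ by applying successively, for each $v\in\hat V\setminus\{r\}$ with $0<\tilde y_v<\delta$ (current value), in some order, a complete splitting at $v$ to $\tilde x$ and setting $\tilde y_v:=0$. *Trees and cores.* Let $\lambda$ be a probability vector on a finite set $\mathcal T$ of trees in $\hat G$, all containing $r$, such that a tree $T$ sampled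 according to $\lambda$ satisfies $\Pr[v\in V(T)]=\tilde y_v$ for all $v\in\hat V\setminus\{r\}$ and $\Pr[e\in E(T)]=\tilde x_e$ for all $e\in\hat E^+$. For a tree $T\in\mathcal T$ and $\gamma\in[0,1]$, let $\operatorname{core}_{\tilde x}(T,\gamma)$ be the minimal subtree of $T$ that contains $r$ and every edge $e\in E(T)\cap\hat E^+$ with $\tilde x_e\ge\gamma$. *Restoration.* Let $H_{T,\gamma}$ be the multigraph in $G$ obtained from $\operatorname{core}_{\tilde x}(T,\gamma)$ by replacing each edge $uv\notin\hat E^+$ by a (fixed, arbitrarily chosen) shortest $u$–$v$ path in $G'$ and then merging all copies back to their original vertices, edges between a copy and its original vertex disappearing. Let $\operatorname{odd}(H_{T,\gamma})$ be its set of odd-degree vertices. For $Q\subseteq V$, a $Q$-join in $G$ is a multiset $J$ of edges of $G$ such that exactly the vertices in $Q$ have odd degree in $(V,J)$; its length is $w(J)=\sum_{e\in J}w_e$, counted with multiplicity. **Lemma.** Fix $\delta,\gamma\in[0,1]$, and let $T\in\mathcal T$ with $\lambda_T>0$. Let $\eta_1>\eta_2>\cdots>\eta_q$ be the distinct positive values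 among $\{\tilde x_e:e\in\hat E^+\}$, put $T_i=\operatorname{core}_{\tilde x}(T,\eta_i)$ for $1\le i\le q$, and let $T_0$ be the tree consisting only of $r$. Then a minimum-length $\operatorname{odd}(H_{T,\gamma})$-join in $G$ exists, and every minimum-length $\operatorname{odd}(H_{T,\gamma})$-join $J_{T,\gamma}$ in $G$ satisfies $$ w(J_{T,\gamma})\;\le\;\frac{1}{3-\delta}\sum_{e\in\hat E}\hat w_e\tilde x_e\;+\;\sum_{i:\,\eta_i\ge\gamma}\Bigl(1-\frac{2\eta_i}{3-\delta}\Bigr)\,\hat w\bigl(E(T_i)\setminus E(T_{i-1})\bigr). $$ -/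

import Mathlib

namespace PCRPP

/-! ## Edge vectors, cuts and trees on a finite complete graph

The edge set of the complete graph on `U` is `(⊤ : SimpleGraph U).edgeSet`, the set of unordered
pairs of distinct vertices. An edge vector is a function on `Sym2 U`; its values on the diagonal
pairs `s(v, v)` are never used. -/

section Complete

variable {U : Type*} [Finite U]

/-- `f(F) = ∑_{e ∈ F} f_e`. -/
noncomputable def total (f : Sym2 U → ℝ) (F : Set (Sym2 U)) : ℝ :=
  ∑ e ∈ F.toFinite.toFinset, f e

/-- `δ(S)`: the edges of the complete graph with exactly one endpoint in `S`. -/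
def cut (S : Set U) : Set (Sym2 U) :=
  {e | ∃ a ∈ S, ∃ b ∉ S, e = s(a, b)}

/-- The minimum `s`-`t` cut size with respect to `x` (for `s ≠ t`). -/
noncomputable def minCut (x : Sym2 U → ℝ) (s t : U) : ℝ :=
  ⨅ S : {S : Set U // s ∈ S ∧ t ∉ S}, total x (cut S.1)

open Classical in
/-- `x'` arises from `x` by one splitting-off operation at `v`; the first alternative is the
non-degenerate case, the second one the degenerate case. -/
def SplitOff (v : U) (x x' : Sym2 U → ℝ) : Prop :=
  (∃ a b : U, ∃ ε : ℝ, a ≠ v ∧ b ≠ v ∧ a ≠ b ∧ 0 < ε ∧ ε ≤ x s(v, a) ∧ ε ≤ x s(v, b) ∧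
    x' = x - Pi.single s(v, a) ε - Pi.single s(v, b) ε + Pi.single s(a, b) ε) ∨
  (∃ a : U, ∃ ε : ℝ, a ≠ v ∧ 0 < ε ∧ ε ≤ x s(v, a) ∧ x' = x - Pi.single s(v, a) ε)

/-- A splitting-off operation at `v` is feasible if it decreases no minimum `s`-`t` cut size with
`s, t ≠ v`. -/
def FeasibleSplitOff (v : U) (x x' : Sym2 U → ℝ) : Prop :=
  SplitOff v x x' ∧ ∀ s t : U, s ≠ v → t ≠ v → s ≠ t → minCut x s t ≤ minCut x' s t

/-- `x'` arises from `x` by a complete splitting at `v`. -/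
def CompleteSplitting (v : U) (x x' : Sym2 U → ℝ) : Prop :=
  Relation.ReflTransGen (FeasibleSplitOff v) x x' ∧ ∀ e ∈ cut {v}, x' e = 0

open Classical in
/-- One pass of the splitting loop with threshold `δ`: a complete splitting is applied at some
vertex `v ≠ r` with `0 < y_v < δ`, and `y_v` is set to `0`. -/
def SplittingPass (r : U) (δ : ℝ) (z z' : (Sym2 U → ℝ) × (U → ℝ)) : Prop :=
  ∃ v : U, v ≠ r ∧ 0 < z.2 v ∧ z.2 v < δ ∧ CompleteSplitting v z.1 z'.1 ∧
    z'.2 = Function.update z.2 v 0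

/-- `z'` is the result of running the splitting loop with threshold `δ` on `z`, with the vertices
taken in some order, until no vertex `v ≠ r` with `0 < y_v < δ` is left. -/
def SplittingResult (r : U) (δ : ℝ) (z z' : (Sym2 U → ℝ) × (U → ℝ)) : Prop :=
  Relation.ReflTransGen (SplittingPass r δ) z z' ∧ ∀ v : U, v ≠ r → ¬ (0 < z'.2 v ∧ z'.2 v < δ)

/-- The feasible region of the linear programming relaxation, for the root `r` and the set `Ep` of
positive-profit edges. -/
structure LPFeasible (r : U) (Ep : Set (Sym2 U)) (x : Sym2 U → ℝ) (y : U → ℝ) : Prop where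
  degree : ∀ v, v ≠ r → total x (cut {v}) = 2 * y v
  degree_root : total x (cut {r}) ≤ 2
  cut_ge : ∀ S : Set U, r ∉ S → ∀ v ∈ S, 2 * y v ≤ total x (cut S)
  couple : ∀ u v, s(u, v) ∈ Ep → y u = y v ∧ y v = x s(u, v)
  root : y r = 1
  pos_edge : ∀ e ∈ Ep, 0 ≤ x e ∧ x e ≤ 1
  zero_edge : ∀ e ∈ (⊤ : SimpleGraph U).edgeSet, e ∉ Ep → 0 ≤ x e
  vertex : ∀ v, v ≠ r → 0 ≤ y v ∧ y v ≤ 1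

open Classical in
/-- A probability vector `lam` on a finite set `𝒯` of trees of the complete graph, all of them
containing the root, in which every non-root vertex `v` is present with probability `y_v` and every
positive-profit edge `e` with probability `x_e`. -/
structure IsTreeDecomposition (r : U) (Ep : Set (Sym2 U)) (x : Sym2 U → ℝ) (y : U → ℝ)
    (𝒯 : Finset (⊤ : SimpleGraph U).Subgraph) (lam : (⊤ : SimpleGraph U).Subgraph → ℝ) :
    Prop where
  isTree : ∀ T ∈ 𝒯, T.coe.IsTree
  root_mem : ∀ T ∈ 𝒯, r ∈ T.verts
  nonneg : ∀ T ∈ 𝒯, 0 ≤ lam T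
  sum_eq_one : ∑ T ∈ 𝒯, lam T = 1
  vertex_prob : ∀ v, v ≠ r → ∑ T ∈ 𝒯 with v ∈ T.verts, lam T = y v
  edge_prob : ∀ e ∈ Ep, ∑ T ∈ 𝒯 with e ∈ T.edgeSet, lam T = x e

/-- The subtrees of `T` that contain `r` and every edge `e ∈ E(T) ∩ Ep` with `x_e ≥ γ`. -/
def coreCandidates (r : U) (Ep : Set (Sym2 U)) (x : Sym2 U → ℝ)
    (T : (⊤ : SimpleGraph U).Subgraph) (γ : ℝ) : Set (⊤ : SimpleGraph U).Subgraph :=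
  {C | C ≤ T ∧ C.coe.IsTree ∧ r ∈ C.verts ∧ ∀ e ∈ T.edgeSet ∩ Ep, γ ≤ x e → e ∈ C.edgeSet}

/-- The edge-profit core `core_x(T, γ)`: the minimal subtree of `T` that contains `r` and every
edge `e ∈ E(T) ∩ Ep` with `x_e ≥ γ`, see `core_isLeast`. -/
def core (r : U) (Ep : Set (Sym2 U)) (x : Sym2 U → ℝ)
    (T : (⊤ : SimpleGraph U).Subgraph) (γ : ℝ) : (⊤ : SimpleGraph U).Subgraph :=
  sInf (coreCandidates r Ep x T γ)

theorem core_isLeast {r : U} {Ep : Set (Sym2 U)} {x : Sym2 U → ℝ}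
    {T : (⊤ : SimpleGraph U).Subgraph} {γ : ℝ} (hT : T.coe.IsTree) (hr : r ∈ T.verts) :
    IsLeast (coreCandidates r Ep x T γ) (core r Ep x T γ) := by
  have hTmem : T ∈ coreCandidates r Ep x T γ := ⟨le_rfl, hT, hr, fun e he _ => he.1⟩
  have hle : core r Ep x T γ ≤ T := sInf_le hTmem
  have hrc : r ∈ (core r Ep x T γ).verts := by
    simp only [core, SimpleGraph.Subgraph.verts_sInf, Set.mem_iInter]
    exact fun C hC => hC.2.2.1
  have hwalk : ∀ u ∈ (core r Ep x T γ).verts, ∃ p : (⊤ : SimpleGraph U).Walk r u,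
      p.toSubgraph ≤ core r Ep x T γ := by
    intro u hu
    have huT : u ∈ T.verts := SimpleGraph.Subgraph.verts_mono hle hu
    obtain ⟨p, hp, huniq⟩ := hT.existsUnique_path ⟨r, hr⟩ ⟨u, huT⟩
    refine ⟨p.map T.hom, le_sInf fun C hC => ?_⟩
    have huC : u ∈ C.verts := 
      SimpleGraph.Subgraph.verts_mono (sInf_le hC : core r Ep x T γ ≤ C) hu
    obtain ⟨w, hw⟩ :=
      (hC.2.1.1.preconnected ⟨r, hC.2.2.1⟩ ⟨u, huC⟩).exists_isPath
    have h := huniq (w.map (SimpleGraph.Subgraph.inclusion hC.1))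
      (hw.map (SimpleGraph.Subgraph.inclusion.injective hC.1))
    have h2 : p.map T.hom = w.map C.hom := by
      subst h
      exact SimpleGraph.Walk.map_map (SimpleGraph.Subgraph.inclusion hC.1) T.hom w
    have h3 : (w.map C.hom).toSubgraph ≤ C := by
      rw [SimpleGraph.Walk.toSubgraph_map]
      calc w.toSubgraph.map C.hom ≤ (⊤ : C.coe.Subgraph).map C.hom :=
            SimpleGraph.Subgraph.map_mono le_top
        _ = C := SimpleGraph.Subgraph.map_hom_top C
    exact h2 ▸ h3
  refine ⟨⟨hle, ⟨?_, ?_⟩, hrc, ?_⟩, fun C hC => sInf_le hC⟩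
  · rw [← SimpleGraph.Subgraph.connected_iff',
      SimpleGraph.Subgraph.connected_iff_forall_exists_walk_subgraph]
    refine ⟨⟨r, hrc⟩, fun {u v} hu hv => ?_⟩
    obtain ⟨p, hp⟩ := hwalk u hu
    obtain ⟨p', hp'⟩ := hwalk v hv
    refine ⟨p.reverse.append p', ?_⟩
    rw [SimpleGraph.Walk.toSubgraph_append, SimpleGraph.Walk.toSubgraph_reverse]
    exact sup_le hp hp'
  · exact hT.2.comap _ (SimpleGraph.Subgraph.inclusion.injective hle)
  · intro e he hx
    simp only [core, SimpleGraph.Subgraph.edgeSet_sInf, Set.mem_inter_iff, Set.mem_iInter]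
    exact ⟨fun C hC => hC.2.2.2 e he hx, T.edgeSet_subset he.1⟩

/-- The sequence `T_0, T_1, T_2, …`: `T_0` is the tree that consists only of the root, and
`T_i = core_x(T, η_i)` for `i ≥ 1`. -/
def coreSeq (r : U) (Ep : Set (Sym2 U)) (x : Sym2 U → ℝ)
    (T : (⊤ : SimpleGraph U).Subgraph) (η : ℕ → ℝ) (i : ℕ) : (⊤ : SimpleGraph U).Subgraph :=
  if i = 0 then (⊤ : SimpleGraph U).singletonSubgraph r else core r Ep x T (η i)

/-- `η_1 > η_2 > ⋯ > η_q` are the distinct positive values among the `x_e` with `e ∈ Ep`. -/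
def EnumeratesPositiveValues (Ep : Set (Sym2 U)) (x : Sym2 U → ℝ) (q : ℕ) (η : ℕ → ℝ) : Prop :=
  StrictAntiOn η (Set.Icc 1 q) ∧ η '' Set.Icc 1 q = {t | 0 < t ∧ ∃ e ∈ Ep, x e = t}

end Complete

/-! ## Edge multisets and joins -/

section Multigraph

variable {V : Type*}

open Classical in
/-- The set of vertices of odd degree in the (loopless) multigraph with edge multiset `H`. -/
def odd (H : Multiset (Sym2 V)) : Set V :=
  {v | Odd (H.countP (fun e => v ∈ e))}

/-- The total length of an edge multiset, counted with multiplicity. -/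
def multiLength (w : Sym2 V → ℝ) (H : Multiset (Sym2 V)) : ℝ :=
  (H.map w).sum

/-- `J` is a `Q`-join in `G`: a multiset of edges of `G` whose odd-degree vertices are exactly
those of `Q`. -/
def IsJoin (G : SimpleGraph V) (Q : Set V) (J : Multiset (Sym2 V)) : Prop :=
  (∀ e ∈ J, e ∈ G.edgeSet) ∧ odd J = Q

/-- `J` is a minimum-length `Q`-join in `G`. -/
def IsMinJoin (G : SimpleGraph V) (w : Sym2 V → ℝ) (Q : Set V) (J : Multiset (Sym2 V)) : Prop :=
  IsJoin G Q J ∧ ∀ J', IsJoin G Q J' → multiLength w J ≤ multiLength w J'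

end Multigraph

/-! ## Instances and their preprocessing -/

/-- A connected instance `G = (V, E; w, p; r)` of the prize-collecting rural postman problem. -/
structure Instance (V : Type*) where
  graph : SimpleGraph V
  length : Sym2 V → ℝ
  profit : Sym2 V → ℝ
  root : V
  connected : graph.Connected
  length_nonneg : ∀ e ∈ graph.edgeSet, 0 ≤ length e
  profit_nonneg : ∀ e ∈ graph.edgeSet, 0 ≤ profit e

namespace Instance

variable {V : Type*} (I : Instance V)

/-- The number of positive-profit edges incident to `v`. -/
noncomputable def posDegree (v : V) : ℕ :=
  {e ∈ I.graph.edgeSet | v ∈ e ∧ 0 < I.profit e}.ncard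

/-- The new vertices of the vertex-copying step. A dart `d` of `G` is an edge together with one of
its endpoints, `d.fst`. A copy of `v` is created for each positive-profit edge at `v` if `v` is the
root or if `v` is incident to at least two positive-profit edges. -/
abbrev Copy : Type _ :=
  {d : I.graph.Dart // 0 < I.profit d.edge ∧ (d.fst = I.root ∨ 2 ≤ I.posDegree d.fst)}

/-- The vertex set after the vertex-copying step. -/
abbrev HatV : Type _ := V ⊕ I.Copy

instance [Finite V] : Finite I.graph.Dart :=
  Finite.of_injective _ SimpleGraph.Dart.toProd_injective

/-- The root, as a vertex after the vertex-copying step. -/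
def hatRoot : I.HatV := Sum.inl I.root

/-- Merging every copy back to its original vertex. -/
def merge : I.HatV → V
  | Sum.inl v => v
  | Sum.inr c => c.1.fst

open Classical in
/-- The vertex to which the end `d.fst` of the positive-profit edge `d.edge` is attached after the
vertex-copying step: its own copy if there is one, and `d.fst` otherwise. -/
noncomputable def attach (d : I.graph.Dart) : I.HatV :=
  if h : 0 < I.profit d.edge ∧ (d.fst = I.root ∨ 2 ≤ I.posDegree d.fst) then Sum.inr ⟨d, h⟩
  else Sum.inl d.fst

/-- The positive-profit edges after the vertex-copying step. They are also the positive-profit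
edges of the preprocessed complete graph, see `hatProfit_pos_iff`. -/
def hatPos : Set (Sym2 I.HatV) :=
  {f | ∃ d : I.graph.Dart, 0 < I.profit d.edge ∧ f = s(I.attach d, I.attach d.symm)}

/-- The graph after the vertex-copying step: the zero-profit edges of `G`, an edge between every
copy and its original vertex, and the reattached positive-profit edges. -/
def copyGraph : SimpleGraph I.HatV :=
  SimpleGraph.fromEdgeSet
    ({f | ∃ u v, I.graph.Adj u v ∧ I.profit s(u, v) = 0 ∧ f = s(Sum.inl u, Sum.inl v)} ∪
      {f | ∃ c : I.Copy, f = s(Sum.inl c.1.fst, Sum.inr c)} ∪ I.hatPos)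

open Classical in
/-- Edge lengths after the vertex-copying step: an edge between a copy and its original vertex
(it is merged to a loop) has length `0`, every other edge keeps the length of the edge of `G` to
which it is merged. -/
noncomputable def copyLength (f : Sym2 I.HatV) : ℝ :=
  if (f.map I.merge).IsDiag then 0 else I.length (f.map I.merge)

/-- The length of a walk in the graph after the vertex-copying step. -/
noncomputable def walkLength {a b : I.HatV} (W : I.copyGraph.Walk a b) : ℝ :=
  (W.edges.map I.copyLength).sum

open Classical in
/-- The edge lengths `ŵ` of the preprocessed complete graph: positive-profit edges keep their
lengths, every other edge `uv` gets the length of a shortest `u`-`v` path after the vertex-copying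
step. -/
noncomputable def hatLength (f : Sym2 I.HatV) : ℝ :=
  if f ∈ I.hatPos then I.copyLength f
  else sInf {l | ∃ a b, ∃ W : I.copyGraph.Walk a b, W.IsPath ∧ s(a, b) = f ∧ l = I.walkLength W}

open Classical in
/-- The edge profits `p̂` of the preprocessed complete graph. -/
noncomputable def hatProfit (f : Sym2 I.HatV) : ℝ :=
  if f ∈ I.hatPos then I.profit (f.map I.merge) else 0

theorem merge_attach (d : I.graph.Dart) : I.merge (I.attach d) = d.fst := by
  unfold attach
  split_ifs <;> rfl

theorem hatProfit_pos_iff (f : Sym2 I.HatV) : 0 < I.hatProfit f ↔ f ∈ I.hatPos := by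
  unfold hatProfit
  split_ifs with h
  · refine ⟨fun _ => h, fun _ => ?_⟩
    obtain ⟨d, hd, rfl⟩ := h
    rw [Sym2.map_mk, merge_attach, merge_attach]
    exact hd
  · simp [h]

section LP

variable [Finite V]

/-- The objective `∑ ŵ_e x_e + ∑ p̂_e (1 - x_e)` of the linear programming relaxation. -/
noncomputable def lpObjective (x : Sym2 I.HatV → ℝ) : ℝ :=
  total (fun e => I.hatLength e * x e) (⊤ : SimpleGraph I.HatV).edgeSet +
    total (fun e => I.hatProfit e * (1 - x e)) (⊤ : SimpleGraph I.HatV).edgeSet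

/-- `(x, y)` is an optimal solution of the linear programming relaxation on the preprocessed
complete graph. -/
def IsLPOptimal (x : Sym2 I.HatV → ℝ) (y : I.HatV → ℝ) : Prop :=
  LPFeasible I.hatRoot I.hatPos x y ∧
    ∀ x' y', LPFeasible I.hatRoot I.hatPos x' y' → I.lpObjective x ≤ I.lpObjective x'

end LP

/-- `P` selects for every zero-profit edge `ab` of the preprocessed complete graph (the edge
multiset of) a shortest `a`-`b` path after the vertex-copying step. -/
def IsShortestPathSystem (P : Sym2 I.HatV → Multiset (Sym2 I.HatV)) : Prop :=
  ∀ a b : I.HatV, a ≠ b → s(a, b) ∉ I.hatPos → ∃ W : I.copyGraph.Walk a b,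
    W.IsPath ∧ I.walkLength W = I.hatLength s(a, b) ∧ P s(a, b) = (W.edges : Multiset _)

open Classical in
/-- The restoration of an edge of the preprocessed complete graph to an edge multiset in `G`: a
zero-profit edge is replaced by its shortest path, a positive-profit edge is kept, then copies are
merged back; the edges between copies and their original vertices disappear. -/
noncomputable def restoreEdge (P : Sym2 I.HatV → Multiset (Sym2 I.HatV)) (f : Sym2 I.HatV) :
    Multiset (Sym2 V) :=
  ((if f ∈ I.hatPos then {f} else P f).map (Sym2.map I.merge)).filter (fun e => ¬ e.IsDiag)

/-- The restoration of a subgraph of the preprocessed complete graph to a multigraph in `G`, given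
by its edge multiset. -/
noncomputable def restore [Finite V] (P : Sym2 I.HatV → Multiset (Sym2 I.HatV))
    (C : (⊤ : SimpleGraph I.HatV).Subgraph) : Multiset (Sym2 V) :=
  ∑ f ∈ C.edgeSet.toFinite.toFinset, I.restoreEdge P f

end Instance

end PCRPP

/-! A minimum join is bounded by a fractional one. Let `Q` be the set of odd vertices of the
restored core. By Edmonds and Johnson, a nonnegative vector of weight at least one on every cut
whose sides contain an odd number of vertices of `Q` costs at least as much as some `Q`-join. It
therefore suffices to exhibit one such vector whose cost is the claimed bound. This vector is
`correction`, z = x / (3 - δ) + ∑ (1 - 2 η_i / (3 - δ)) χ(E(T_i) \ E(T_{i-1})), with the sum over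
all i with η_i ≥ γ.

It lives on the preprocessed graph and is pushed forward along the merging of copies. Every core
edge is restored to a join of its merged ends, so a cut of `G` is odd for `Q` exactly if its
preimage contains an odd number of core edges (`odd_card_inter_odd_restore_iff`). Hence only cuts
δ(S) with an odd number of core edges matter, and S may be assumed to avoid the root.

If δ(S) contains a single core edge, lying in layer i, then the minimality of T_i puts an end of
some positive-profit edge f with x_f ≥ η_i into S. So x(δ(S)) ≥ 2 η_i, which the layer coefficient
complements to one. If δ(S) contains at least three core edges, then S contains a vertex of T; such
a vertex survived the splitting, so x(δ(S)) ≥ 2δ. Each of the core edges adds at least (1 - δ) / (3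
- δ), and 2δ + 3(1 - δ) = 3 - δ. This is `one_le_total_correction`. The cut constraints x(δ(S)) ≥ 2
y_v remain valid after splitting because feasible operations decrease no minimum cut to the root
(`SplittingPass.cutFeasible`).

The Edmonds–Johnson bound is `exists_isJoin_le`. For metric costs, splitting off turns a solution of
the cut constraints into a point of the perfect matching polytope of `Q` without raising the cost
(`exists_perfectMatching_le`). By Edmonds' theorem (`matchingPolytope_subset_convexHull`) some
perfect matching is no more expensive, and its edges are replaced by minimum joins of their ends. -/

namespace PCRPP

/-! ### Cuts in multigraphs, contraction of tight odd sets, and gluing of matchings. -/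

section Contraction

variable {E W : Type*} [Fintype E] [DecidableEq W]

/-- The total weight `∑_{e ∈ δ(S)} z_e` of the cut `δ(S)` in the multigraph on `W` whose edges `e`
have the ends `f e` and `g e`. -/
def cutSum (f g : E → W) (z : E → ℝ) (S : Finset W) : ℝ :=
  ∑ e, if (f e ∈ S ↔ g e ∈ S) then 0 else z e

/-- `z` is a fractional perfect matching on the vertex set `T`. -/
structure IsFractionalMatching (f g : E → W) (T : Finset W) (z : E → ℝ) : Prop where
  nonneg : ∀ e, 0 ≤ z e
  supp : ∀ e, z e ≠ 0 → f e ≠ g e ∧ f e ∈ T ∧ g e ∈ T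
  degree : ∀ v ∈ T, cutSum f g z {v} = 1

/-- The incidence vectors of the perfect matchings on the vertex set `T`. -/
def perfectMatchings (f g : E → W) (T : Finset W) : Set (E → ℝ) :=
  {p | IsFractionalMatching f g T p ∧ ∀ e, p e = 0 ∨ p e = 1}

/-- Edmonds' description of the perfect matching polytope. -/
def matchingPolytope (f g : E → W) (T : Finset W) : Set (E → ℝ) :=
  {z | IsFractionalMatching f g T z ∧ ∀ S : Finset W, Odd (S ∩ T).card → 1 ≤ cutSum f g z S}

/-- Contraction of the vertex set `S` to its member `s`. -/
def contract (S : Finset W) (s w : W) : W := if w ∈ S then s else w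

theorem cutSum_add (f g : E → W) (z z' : E → ℝ) (S : Finset W) :
    cutSum f g (z + z') S = cutSum f g z S + cutSum f g z' S := by
  simp only [cutSum, ← Finset.sum_add_distrib, Pi.add_apply]
  refine Finset.sum_congr rfl fun e _ => ?_
  split_ifs <;> simp

theorem cutSum_smul (f g : E → W) (c : ℝ) (z : E → ℝ) (S : Finset W) :
    cutSum f g (c • z) S = c * cutSum f g z S := by
  simp only [cutSum, Finset.mul_sum, Pi.smul_apply, smul_eq_mul]
  refine Finset.sum_congr rfl fun e _ => ?_
  split_ifs <;> simp

theorem cutSum_empty (f g : E → W) (z : E → ℝ) : cutSum f g z ∅ = 0 := by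
  simp [cutSum]

theorem continuous_cutSum (f g : E → W) (S : Finset W) :
    Continuous fun z : E → ℝ => cutSum f g z S := by
  unfold cutSum
  refine continuous_finsetSum _ fun e _ => ?_
  split_ifs
  · exact continuous_const
  · exact continuous_apply e

theorem cutSum_inter_of_supp {f g : E → W} {T : Finset W} {z : E → ℝ}
    (h : ∀ e, z e ≠ 0 → f e ≠ g e ∧ f e ∈ T ∧ g e ∈ T) (S : Finset W) :
    cutSum f g z (S ∩ T) = cutSum f g z S := by
  unfold cutSum
  refine Finset.sum_congr rfl fun e _ => ?_
  by_cases he : z e = 0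
  · simp [he]
  · obtain ⟨-, h1, h2⟩ := h e he
    simp [h1, h2]

/-- A 0/1 vector whose values on a cut sum to one is, on that cut, the unit vector of an edge. -/
theorem eq_of_cutSum_eq_one {f g : E → W} {p q : E → ℝ} {S : Finset W}
    (hp0 : ∀ e, p e = 0 ∨ p e = 1) (hq0 : ∀ e, q e = 0 ∨ q e = 1)
    (hp : cutSum f g p S = 1) (hq : cutSum f g q S = 1) {e : E} (he : ¬ (f e ∈ S ↔ g e ∈ S))
    (hpe : p e = 1) (hqe : q e = 1) : ∀ e', ¬ (f e' ∈ S ↔ g e' ∈ S) → p e' = q e' := by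
  classical
  have key : ∀ r : E → ℝ, (∀ e, r e = 0 ∨ r e = 1) → cutSum f g r S = 1 → r e = 1 →
      ∀ e', ¬ (f e' ∈ S ↔ g e' ∈ S) → e' ≠ e → r e' = 0 := by
    intro r hr0 hr hre e' he' hne
    rcases hr0 e' with h | h
    · exact h
    exfalso
    have hnn : ∀ i ∈ Finset.univ, 0 ≤ (if (f i ∈ S ↔ g i ∈ S) then 0 else r i) := by
      intro i _
      split_ifs
      · exact le_rfl
      · rcases hr0 i with h | h <;> simp [h]
    have h2 : ∑ i ∈ {e, e'}, (if (f i ∈ S ↔ g i ∈ S) then 0 else r i) ≤ cutSum f g r S :=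
      Finset.sum_le_sum_of_subset_of_nonneg (Finset.subset_univ _) fun i hi _ => hnn i hi
    rw [Finset.sum_pair hne.symm, if_neg he, if_neg he', hr, hre, h] at h2
    norm_num at h2
  intro e' he'
  by_cases h : e' = e
  · rw [h, hpe, hqe]
  · rw [key p hp0 hp hpe e' he' h, key q hq0 hq hqe e' he' h]

variable [Fintype W]

theorem cutSum_compl (f g : E → W) (z : E → ℝ) (S : Finset W) :
    cutSum f g z Sᶜ = cutSum f g z S := by
  simp only [cutSum, Finset.mem_compl, not_iff_not]

theorem cutSum_univ (f g : E → W) (z : E → ℝ) : cutSum f g z Finset.univ = 0 := by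
  simp [cutSum]

theorem cutSum_comp (f g : E → W) (z : E → ℝ) (π : W → W) (X : Finset W) :
    cutSum (π ∘ f) (π ∘ g) z X = cutSum f g z (Finset.univ.filter fun w => π w ∈ X) := by
  simp [cutSum]

theorem preimage_contract_self {S : Finset W} {s : W} (hs : s ∈ S) :
    (Finset.univ.filter fun w => contract S s w ∈ ({s} : Finset W)) = S := by
  ext w
  by_cases hw : w ∈ S
  · simp [contract, hw]
  · have : w ≠ s := fun h => hw (h ▸ hs)
    simp [contract, hw, this]

theorem preimage_contract_of_notMem {S : Finset W} {s v : W} (hs : s ∈ S) (hv : v ∉ S) :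
    (Finset.univ.filter fun w => contract S s w ∈ ({v} : Finset W)) = {v} := by
  have hsv : s ≠ v := fun h => hv (h ▸ hs)
  ext w
  by_cases hw : w ∈ S
  · have : w ≠ v := fun h => hv (h ▸ hw)
    simp [contract, hw, this, hsv]
  · simp [contract, hw]

/-- Taking preimages replaces the single vertex `s` by the set `S ∩ T`, which is odd as well, so
parity does not change. -/
theorem odd_card_preimage_contract {S T X : Finset W} {s : W} (hs : s ∈ S)
    (hST : Odd (S ∩ T).card) (hX : Odd (X ∩ insert s (T \ S)).card) :
    Odd ((Finset.univ.filter fun w => contract S s w ∈ X) ∩ T).card := by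
  have hd : ∀ Y : Finset W, Disjoint (X ∩ (T \ S)) (S ∩ Y) := fun Y =>
    Finset.disjoint_left.2 fun w h1 h2 =>
      (Finset.mem_sdiff.1 (Finset.mem_inter.1 h1).2).2 (Finset.mem_inter.1 h2).1
  by_cases hsX : s ∈ X
  · have e1 : (Finset.univ.filter fun w => contract S s w ∈ X) ∩ T =
        (X ∩ (T \ S)) ∪ (S ∩ T) := by
      ext w
      simp only [Finset.mem_inter, Finset.mem_filter, Finset.mem_univ, true_and]
      by_cases hw : w ∈ S <;> simp [contract, hw, hsX]
    have e2 : X ∩ insert s (T \ S) = insert s (X ∩ (T \ S)) := by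
      ext w
      by_cases hw : w = s <;> simp [hw, hsX]
    rw [e2, Finset.card_insert_of_notMem (by simp [hs]), Nat.odd_add_one] at hX
    rw [e1, Finset.card_union_of_disjoint (hd T)]
    exact (Nat.not_odd_iff_even.1 hX).add_odd hST
  · have e1 : (Finset.univ.filter fun w => contract S s w ∈ X) ∩ T =
        X ∩ insert s (T \ S) := by
      ext w
      simp only [Finset.mem_inter, Finset.mem_filter, Finset.mem_univ, true_and]
      by_cases hw : w ∈ S
      · have : w ∈ X → w ≠ s := fun h h' => hsX (h' ▸ h)
        simp [contract, hw, hsX]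
        tauto
      · have : w ≠ s := fun h => hw (h ▸ hs)
        simp [contract, hw, this]
    rwa [e1]

/-- Restriction of a point of the matching polytope to a contraction of a tight odd set. -/
theorem contract_mem_matchingPolytope {f g : E → W} {T S : Finset W} {s : W} {z : E → ℝ}
    (hz : z ∈ matchingPolytope f g T) (hs : s ∈ S) (hST : Odd (S ∩ T).card)
    (hS : cutSum f g z S = 1) :
    (fun e => if f e ∈ S ∧ g e ∈ S then 0 else z e) ∈
      matchingPolytope (contract S s ∘ f) (contract S s ∘ g) (insert s (T \ S)) := by
  -- Edges inside `S` become loops. They lie in no cut, so setting them to zero, as `supp` demands,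
  -- changes no cut value.
  have hcut : ∀ X, cutSum (contract S s ∘ f) (contract S s ∘ g)
      (fun e => if f e ∈ S ∧ g e ∈ S then 0 else z e) X =
      cutSum f g z (Finset.univ.filter fun w => contract S s w ∈ X) := by
    intro X
    rw [← cutSum_comp]
    unfold cutSum
    refine Finset.sum_congr rfl fun e _ => ?_
    by_cases h : f e ∈ S ∧ g e ∈ S
    · simp [contract, h.1, h.2]
    · simp only [h, if_false]
  refine ⟨⟨fun e => ?_, fun e he => ?_, fun v hv => ?_⟩, fun X hX => ?_⟩
  · split_ifs
    exacts [le_rfl, hz.1.nonneg e]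
  · by_cases h : f e ∈ S ∧ g e ∈ S
    · simp [h] at he
    · simp only [h, if_false] at he
      obtain ⟨h1, h2, h3⟩ := hz.1.supp e he
      by_cases hf : f e ∈ S <;> by_cases hg : g e ∈ S
      · exact absurd ⟨hf, hg⟩ h
      · have : s ≠ g e := fun h => hg (h ▸ hs)
        simp [contract, hf, hg, h3, this]
      · have : f e ≠ s := fun h => hf (h ▸ hs)
        simp [contract, hf, hg, h2, this]
      · simp [contract, hf, hg, h1, h2, h3]
  · rw [hcut]
    rcases Finset.mem_insert.1 hv with rfl | hv
    · rw [preimage_contract_self hs, hS]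
    · rw [preimage_contract_of_notMem hs (Finset.mem_sdiff.1 hv).2]
      exact hz.1.degree v (Finset.mem_sdiff.1 hv).1
  · rw [hcut]
    exact hz.2 _ (odd_card_preimage_contract hs hST hX)

/-- Gluing of two perfect matchings of the contractions of `S` and `Sᶜ`. -/
theorem glue_mem_perfectMatchings {f g : E → W} {T S : Finset W} {s t : W} {p q : E → ℝ}
    (hs : s ∈ S) (ht : t ∈ Sᶜ)
    (hp : p ∈ perfectMatchings (contract S s ∘ f) (contract S s ∘ g) (insert s (T \ S)))
    (hq : q ∈ perfectMatchings (contract Sᶜ t ∘ f) (contract Sᶜ t ∘ g) (insert t (T \ Sᶜ)))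
    (hsupp : ∀ e, ¬ (f e ∈ T ∧ g e ∈ T) → p e = 0 ∧ q e = 0)
    (hpq : ∀ e, ¬ (f e ∈ S ↔ g e ∈ S) → p e = q e) :
    (fun e => if f e ∈ S ∧ g e ∈ S then q e else p e) ∈ perfectMatchings f g T := by
  refine ⟨⟨fun e => ?_, fun e he => ?_, fun v hv => ?_⟩, fun e => ?_⟩
  · split_ifs
    exacts [hq.1.nonneg e, hp.1.nonneg e]
  · have hT : f e ∈ T ∧ g e ∈ T := by
      by_contra h
      rw [(hsupp e h).1, (hsupp e h).2] at he
      simp at he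
    refine ⟨fun hfg => ?_, hT⟩
    split_ifs at he
    · exact (hq.1.supp e he).1 (by simp [hfg])
    · exact (hp.1.supp e he).1 (by simp [hfg])
  · by_cases hvS : v ∈ S
    -- Degrees inside `S` are those of `q`, which leaves `S` uncontracted; the crossing edges carry
    -- `p`, which agrees with `q` there. Outside `S` the roles are exchanged.
    · rw [← hq.1.degree v (by simp [hv, hvS]), cutSum_comp,
        preimage_contract_of_notMem ht (by simpa using hvS)]
      unfold cutSum
      refine Finset.sum_congr rfl fun e _ => ?_
      dsimp only
      split_ifs with h1 h2
      · rfl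
      · rfl
      · refine hpq e fun h => ?_
        simp only [Finset.mem_singleton] at h1
        have : ¬ (f e ∈ S) := fun hf => h2 ⟨hf, h.1 hf⟩
        have h3 : f e ≠ v := fun h' => this (h' ▸ hvS)
        have h4 : g e ≠ v := fun h' => this (h.2 (h' ▸ hvS))
        exact h1 (by simp [h3, h4])
    · rw [← hp.1.degree v (by simp [hv, hvS]), cutSum_comp, preimage_contract_of_notMem hs hvS]
      unfold cutSum
      refine Finset.sum_congr rfl fun e _ => ?_
      dsimp only
      split_ifs with h1 h2
      · rfl
      · exfalso
        have h3 : f e ≠ v := fun h' => hvS (h' ▸ h2.1)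
        have h4 : g e ≠ v := fun h' => hvS (h' ▸ h2.2)
        exact h1 (by simp [h3, h4])
      · rfl
  · dsimp only
    split_ifs
    exacts [hq.2 e, hp.2 e]

/-- Both contractions of a tight cut give a random matching with exactly one crossing edge, and in
both the crossing edge `e` has probability `z e`. The two are coupled: the crossing edge is shared,
and given that edge the two sides are independent. Gluing the coupled pairs yields a distribution on
perfect matchings with mean `z`. -/
theorem mem_convexHull_of_glue {f g : E → W} {T S : Finset W} {s t : W} {z : E → ℝ}
    (hz : z ∈ matchingPolytope f g T) (hs : s ∈ S) (ht : t ∈ Sᶜ)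
    (hA : (fun e => if f e ∈ S ∧ g e ∈ S then 0 else z e) ∈ convexHull ℝ
      (perfectMatchings (contract S s ∘ f) (contract S s ∘ g) (insert s (T \ S))))
    (hB : (fun e => if f e ∈ Sᶜ ∧ g e ∈ Sᶜ then 0 else z e) ∈ convexHull ℝ
      (perfectMatchings (contract Sᶜ t ∘ f) (contract Sᶜ t ∘ g) (insert t (T \ Sᶜ)))) :
    z ∈ convexHull ℝ (perfectMatchings f g T) := by
  classical
  obtain ⟨ι, _, a, p, ha0, ha1, hp, hpz⟩ := mem_convexHull_iff_exists_fintype.1 hA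
  obtain ⟨κ, _, b, q, hb0, hb1, hq, hqz⟩ := mem_convexHull_iff_exists_fintype.1 hB
  have hpz' : ∀ e, ∑ i, a i * p i e = if f e ∈ S ∧ g e ∈ S then 0 else z e := fun e => by
    rw [← congrFun hpz e]; simp
  have hqz' : ∀ e, ∑ j, b j * q j e = if f e ∈ Sᶜ ∧ g e ∈ Sᶜ then 0 else z e := fun e => by
    rw [← congrFun hqz e]; simp
  have hap : ∀ i e, z e = 0 → a i * p i e = 0 := fun i e he => by
    have h0 : ∑ i, a i * p i e = 0 := by rw [hpz']; simp [he]
    exact (Finset.sum_eq_zero_iff_of_nonneg fun i _ =>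
      mul_nonneg (ha0 i) ((hp i).1.nonneg e)).1 h0 i (Finset.mem_univ _)
  have hbq : ∀ j e, z e = 0 → b j * q j e = 0 := fun j e he => by
    have h0 : ∑ j, b j * q j e = 0 := by rw [hqz']; simp [he]
    exact (Finset.sum_eq_zero_iff_of_nonneg fun j _ =>
      mul_nonneg (hb0 j) ((hq j).1.nonneg e)).1 h0 j (Finset.mem_univ _)
  have hpS : ∀ i, cutSum f g (p i) S = 1 := fun i => by
    rw [← (hp i).1.degree s (by simp), cutSum_comp, preimage_contract_self hs]
  have hqS : ∀ j, cutSum f g (q j) S = 1 := fun j => by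
    rw [← (hq j).1.degree t (by simp), cutSum_comp, preimage_contract_self ht, cutSum_compl]
  -- `w (i, j)` is the probability of the pair in the coupling. A quotient with `z e = 0` has the
  -- default value zero, which is harmless: by `hap` and `hbq` no matching of positive weight uses
  -- such an edge.
  let c : ι → κ → ℝ := fun i j => ∑ e, if (f e ∈ S ↔ g e ∈ S) then 0 else p i e * q j e / z e
  let w : ι × κ → ℝ := fun ij => a ij.1 * b ij.2 * c ij.1 ij.2
  let r : ι × κ → E → ℝ := fun ij e => if f e ∈ S ∧ g e ∈ S then q ij.2 e else p ij.1 e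
  have hc0 : ∀ i j, 0 ≤ c i j := fun i j => Finset.sum_nonneg fun e _ => by
    split_ifs
    · exact le_rfl
    · exact div_nonneg (mul_nonneg ((hp i).1.nonneg e) ((hq j).1.nonneg e)) (hz.1.nonneg e)
  have hw0 : ∀ ij, 0 ≤ w ij := fun ij => mul_nonneg (mul_nonneg (ha0 _) (hb0 _)) (hc0 _ _)
  have hmargA : ∀ i, ∑ j, w (i, j) = a i := fun i => by
    calc ∑ j, w (i, j)
        = ∑ j, ∑ e, a i * (if (f e ∈ S ↔ g e ∈ S) then 0 else p i e) / z e * (b j * q j e) := by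
          refine Finset.sum_congr rfl fun j _ => ?_
          simp only [w, c, Finset.mul_sum]
          refine Finset.sum_congr rfl fun e _ => ?_
          split_ifs
          · simp
          · ring
      _ = ∑ e, a i * (if (f e ∈ S ↔ g e ∈ S) then 0 else p i e) / z e * ∑ j, b j * q j e := by
          rw [Finset.sum_comm]
          simp only [Finset.mul_sum]
      _ = ∑ e, a i * (if (f e ∈ S ↔ g e ∈ S) then 0 else p i e) := by
          refine Finset.sum_congr rfl fun e _ => ?_
          rw [hqz']
          by_cases h : (f e ∈ S ↔ g e ∈ S)
          · simp [h]
          · have h' : ¬ (f e ∈ Sᶜ ∧ g e ∈ Sᶜ) := by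
              simp only [Finset.mem_compl]; tauto
            rw [if_neg h, if_neg h']
            by_cases hze : z e = 0
            · simp [hap i e hze]
            · field_simp
      _ = a i := by
          rw [← Finset.mul_sum]
          have := hpS i
          unfold cutSum at this
          rw [this, mul_one]
  have hmargB : ∀ j, ∑ i, w (i, j) = b j := fun j => by
    calc ∑ i, w (i, j)
        = ∑ i, ∑ e, b j * (if (f e ∈ S ↔ g e ∈ S) then 0 else q j e) / z e * (a i * p i e) := by
          refine Finset.sum_congr rfl fun i _ => ?_
          simp only [w, c, Finset.mul_sum]
          refine Finset.sum_congr rfl fun e _ => ?_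
          split_ifs
          · simp
          · ring
      _ = ∑ e, b j * (if (f e ∈ S ↔ g e ∈ S) then 0 else q j e) / z e * ∑ i, a i * p i e := by
          rw [Finset.sum_comm]
          simp only [Finset.mul_sum]
      _ = ∑ e, b j * (if (f e ∈ S ↔ g e ∈ S) then 0 else q j e) := by
          refine Finset.sum_congr rfl fun e _ => ?_
          rw [hpz']
          by_cases h : (f e ∈ S ↔ g e ∈ S)
          · simp [h]
          · have h' : ¬ (f e ∈ S ∧ g e ∈ S) := by tauto
            rw [if_neg h, if_neg h']
            by_cases hze : z e = 0
            · simp [hbq j e hze]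
            · field_simp
      _ = b j := by
          rw [← Finset.mul_sum]
          have := hqS j
          unfold cutSum at this
          rw [this, mul_one]
  have hsum : ∑ ij, w ij = 1 := by
    rw [Fintype.sum_prod_type]
    simp only [hmargA, ha1]
  have hval : ∑ ij, w ij • r ij = z := by
    funext e
    rw [Finset.sum_apply]
    simp only [Pi.smul_apply, smul_eq_mul, r]
    by_cases h : f e ∈ S ∧ g e ∈ S
    · simp only [h, and_self, if_true]
      rw [Fintype.sum_prod_type, Finset.sum_comm]
      simp only [← Finset.sum_mul, hmargB]
      rw [hqz', if_neg (by simp [h])]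
    · simp only [h, if_false]
      rw [Fintype.sum_prod_type]
      simp only [← Finset.sum_mul, hmargA]
      rw [hpz', if_neg h]
  have hmem : ∀ ij, w ij ≠ 0 → r ij ∈ perfectMatchings f g T := by
    rintro ⟨i, j⟩ hij
    have hai : a i ≠ 0 := fun h => hij (by simp [w, h])
    have hbj : b j ≠ 0 := fun h => hij (by simp [w, h])
    have hcij : c i j ≠ 0 := fun h => hij (by simp [w, h])
    obtain ⟨e, -, he⟩ := Finset.exists_ne_zero_of_sum_ne_zero hcij
    have hcut : ¬ (f e ∈ S ↔ g e ∈ S) := fun h => he (by simp [h])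
    rw [if_neg hcut] at he
    have hpe : p i e = 1 := ((hp i).2 e).resolve_left fun h => he (by simp [h])
    have hqe : q j e = 1 := ((hq j).2 e).resolve_left fun h => he (by simp [h])
    refine glue_mem_perfectMatchings hs ht (hp i) (hq j) (fun e' he' => ?_)
      (eq_of_cutSum_eq_one (hp i).2 (hq j).2 (hpS i) (hqS j) hcut hpe hqe)
    have hz0 : z e' = 0 := by
      by_contra h
      exact he' (hz.1.supp e' h).2
    exact ⟨(mul_eq_zero.1 (hap i e' hz0)).resolve_left hai,
      (mul_eq_zero.1 (hbq j e' hz0)).resolve_left hbj⟩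
  -- Pairs of weight zero need not share a crossing edge, so their gluing need not be a matching;
  -- they are dropped first.
  rw [← hval, ← Finset.sum_filter_of_ne (p := fun ij => w ij ≠ 0)
    (fun ij _ h h0 => h (by simp [h0]))]
  refine (convex_convexHull ℝ _).sum_mem (fun ij _ => hw0 ij) ?_ fun ij hij =>
    subset_convexHull ℝ _ (hmem ij (Finset.mem_filter.1 hij).2)
  rw [Finset.sum_filter_ne_zero, hsum]

end Contraction

/-! ### Edges of value one and extreme points of the matching polytope. -/

section ExtremePoints

set_option linter.unusedSectionVars false

variable {E W : Type*} [Fintype E] [DecidableEq W]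

theorem cutSum_single [DecidableEq E] (f g : E → W) (e : E) (c : ℝ) (S : Finset W) :
    cutSum f g (Pi.single e c) S = if (f e ∈ S ↔ g e ∈ S) then 0 else c := by
  unfold cutSum
  rw [Finset.sum_eq_single e]
  · simp
  · intro e' _ h
    simp [Pi.single_eq_of_ne h]
  · simp

theorem cutSum_sub (f g : E → W) (z z' : E → ℝ) (S : Finset W) :
    cutSum f g (z - z') S = cutSum f g z S - cutSum f g z' S := by
  have h := cutSum_add f g (z - z') z' S
  rw [sub_add_cancel] at h
  linarith

theorem exists_sym2_eq_of_mem_cut {f g : E → W} {e : E} {b : W}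
    (h : ¬ (f e ∈ ({b} : Finset W) ↔ g e ∈ ({b} : Finset W))) :
    ∃ a, a ≠ b ∧ s(f e, g e) = s(b, a) := by
  simp only [Finset.mem_singleton] at h
  by_cases hf : f e = b
  · exact ⟨g e, fun hg => h (by simp [hf, hg]), by rw [hf]⟩
  · have hg : g e = b := by tauto
    exact ⟨f e, hf, by rw [hg, Sym2.eq_swap]⟩

theorem mem_iff_mem_of_sym2_eq {f g : E → W} {e : E} {a b : W} (h : s(f e, g e) = s(a, b))
    (S : Finset W) : (f e ∈ S ↔ g e ∈ S) ↔ (a ∈ S ↔ b ∈ S) := by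
  rcases Sym2.eq_iff.1 h with ⟨h1, h2⟩ | ⟨h1, h2⟩ <;> rw [h1, h2]
  exact iff_comm

theorem sum_le_cutSum {f g : E → W} {z : E → ℝ} (hz : ∀ e, 0 ≤ z e) {S : Finset W}
    {A : Finset E} (hA : ∀ e ∈ A, ¬ (f e ∈ S ↔ g e ∈ S)) : ∑ e ∈ A, z e ≤ cutSum f g z S := by
  unfold cutSum
  calc ∑ e ∈ A, z e = ∑ e ∈ A, if (f e ∈ S ↔ g e ∈ S) then 0 else z e :=
        Finset.sum_congr rfl fun e he => by rw [if_neg (hA e he)]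
    _ ≤ _ := Finset.sum_le_sum_of_subset_of_nonneg (Finset.subset_univ _) fun e _ _ => by
        split_ifs
        exacts [le_rfl, hz e]

namespace IsFractionalMatching

variable {f g : E → W} {T : Finset W} {z : E → ℝ}

theorem mem_of_sym2_eq (hz : IsFractionalMatching f g T z) {e : E} (he : z e ≠ 0) {a b : W}
    (h : s(f e, g e) = s(a, b)) : a ∈ T ∧ b ∈ T := by
  obtain ⟨-, h1, h2⟩ := hz.supp e he
  rcases Sym2.eq_iff.1 h with ⟨h3, h4⟩ | ⟨h3, h4⟩ <;> rw [h3] at h1 <;> rw [h4] at h2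
  exacts [⟨h1, h2⟩, ⟨h2, h1⟩]

theorem le_one (hz : IsFractionalMatching f g T z) (e : E) : z e ≤ 1 := by
  by_cases he : z e = 0
  · simp [he]
  obtain ⟨h1, h2, -⟩ := hz.supp e he
  have := sum_le_cutSum (f := f) (g := g) hz.nonneg (S := {f e}) (A := {e})
    (by simpa using h1.symm)
  rwa [hz.degree _ h2, Finset.sum_singleton] at this

theorem eq_zero_of_eq_one (hz : IsFractionalMatching f g T z) {v : W} (hv : v ∈ T) {e e' : E}
    (he : ¬ (f e ∈ ({v} : Finset W) ↔ g e ∈ ({v} : Finset W))) (h1 : z e = 1)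
    (he' : ¬ (f e' ∈ ({v} : Finset W) ↔ g e' ∈ ({v} : Finset W))) (hne : e' ≠ e) : z e' = 0 := by
  classical
  have := sum_le_cutSum (f := f) (g := g) hz.nonneg (S := {v}) (A := {e, e'}) (by
    intro i hi
    rcases Finset.mem_insert.1 hi with rfl | hi
    · exact he
    · rwa [Finset.mem_singleton.1 hi])
  rw [hz.degree v hv, Finset.sum_pair hne.symm, h1] at this
  linarith [hz.nonneg e']

/-- A support edge of value other than one is not the only support edge at a vertex. -/
theorem exists_other (hz : IsFractionalMatching f g T z) {v : W} (hv : v ∈ T) (e : E)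
    (h1 : z e ≠ 1) : ∃ e', e' ≠ e ∧ z e' ≠ 0 ∧
      ¬ (f e' ∈ ({v} : Finset W) ↔ g e' ∈ ({v} : Finset W)) := by
  classical
  by_contra! h
  have h2 := hz.degree v hv
  unfold cutSum at h2
  rw [Finset.sum_eq_single e] at h2
  · split_ifs at h2
    · norm_num at h2
    · exact h1 h2
  · intro e' _ hne
    split_ifs with h3
    · rfl
    · by_contra h4
      exact h3 (h e' hne h4)
  · simp

end IsFractionalMatching

variable [Fintype W]

/-- The cut of the whole vertex set is empty, so an odd-cut constraint on it cannot be satisfied. -/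
theorem even_card_of_mem_matchingPolytope {f g : E → W} {T : Finset W} {z : E → ℝ}
    (hz : z ∈ matchingPolytope f g T) : Even T.card := by
  by_contra h
  have := hz.2 Finset.univ (by simpa using h)
  rw [cutSum_univ] at this
  norm_num at this

/-- An edge of value one saturates both of its ends, so all other support edges avoid them and what
remains is a point for the remaining vertices. -/
theorem sub_single_mem_matchingPolytope [DecidableEq E] {f g : E → W} {T : Finset W} {z : E → ℝ}
    (hz : z ∈ matchingPolytope f g T) {e : E} (he : z e = 1) :
    z - Pi.single e 1 ∈ matchingPolytope f g (T \ {f e, g e}) := by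
  obtain ⟨hfg, hf, hg⟩ := hz.1.supp e (by simp [he])
  have hsupp : ∀ e', (z - Pi.single e 1 : E → ℝ) e' ≠ 0 →
      f e' ≠ g e' ∧ f e' ∈ T \ {f e, g e} ∧ g e' ∈ T \ {f e, g e} := by
    intro e' h
    have hne : e' ≠ e := by
      rintro rfl
      simp [he] at h
    have hz' : z e' ≠ 0 := by simpa [Pi.single_eq_of_ne hne] using h
    obtain ⟨h1, h2, h3⟩ := hz.1.supp e' hz'
    have key : ∀ v, v = f e ∨ v = g e → (f e' = v ↔ g e' = v) := by
      intro v hv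
      by_contra hc
      refine hz' (hz.1.eq_zero_of_eq_one (v := v) ?_ (e := e) ?_ he (by simpa using hc) hne)
      · rcases hv with rfl | rfl <;> assumption
      · rcases hv with rfl | rfl
        · simpa using hfg.symm
        · simpa using hfg
    have k1 := key (f e) (Or.inl rfl)
    have k2 := key (g e) (Or.inr rfl)
    refine ⟨h1, ?_, ?_⟩
    · simp only [Finset.mem_sdiff, h2, Finset.mem_insert, Finset.mem_singleton, true_and]
      rintro (h | h)
      · exact h1 (h.trans (k1.1 h).symm)
      · exact h1 (h.trans (k2.1 h).symm)
    · simp only [Finset.mem_sdiff, h3, Finset.mem_insert, Finset.mem_singleton, true_and]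
      rintro (h | h)
      · exact h1 ((k1.2 h).trans h.symm)
      · exact h1 ((k2.2 h).trans h.symm)
  have hcut : ∀ X ⊆ T \ {f e, g e}, cutSum f g (z - Pi.single e 1) X = cutSum f g z X := by
    intro X hX
    have h1 : f e ∉ X := fun h => by simpa using hX h
    have h2 : g e ∉ X := fun h => by simpa using hX h
    rw [cutSum_sub, cutSum_single]
    simp [h1, h2]
  refine ⟨⟨fun e' => ?_, hsupp, fun v hv => ?_⟩, fun X hX => ?_⟩
  · by_cases h : e' = e
    · simp [h, he]
    · simpa [Pi.single_eq_of_ne h] using hz.1.nonneg e'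
  · rw [hcut _ (by simpa using hv)]
    exact hz.1.degree v (Finset.mem_sdiff.1 hv).1
  · rw [← cutSum_inter_of_supp hsupp, hcut _ Finset.inter_subset_right]
    refine hz.2 _ ?_
    rwa [Finset.inter_assoc, Finset.inter_eq_left.2 (Finset.sdiff_subset (s := T))]

theorem add_single_mem_perfectMatchings [DecidableEq E] {f g : E → W} {T : Finset W} {p : E → ℝ}
    {e : E} (hfg : f e ≠ g e) (hf : f e ∈ T) (hg : g e ∈ T)
    (hp : p ∈ perfectMatchings f g (T \ {f e, g e})) :
    p + Pi.single e 1 ∈ perfectMatchings f g T := by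
  have hpe : p e = 0 := by
    by_contra h
    simpa using (hp.1.supp e h).2.1
  refine ⟨⟨fun e' => ?_, fun e' he' => ?_, fun v hv => ?_⟩, fun e' => ?_⟩
  · by_cases h : e' = e
    · simp [h, hpe]
    · simpa [Pi.single_eq_of_ne h] using hp.1.nonneg e'
  · by_cases h : e' = e
    · rw [h]
      exact ⟨hfg, hf, hg⟩
    · have := hp.1.supp e' (by simpa [Pi.single_eq_of_ne h] using he')
      exact ⟨this.1, (Finset.mem_sdiff.1 this.2.1).1, (Finset.mem_sdiff.1 this.2.2).1⟩
  · rw [cutSum_add, cutSum_single]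
    by_cases hvS : v = f e ∨ v = g e
    · rw [if_neg]
      · rw [← cutSum_inter_of_supp hp.1.supp]
        have : ({v} : Finset W) ∩ (T \ {f e, g e}) = ∅ := by
          ext w
          simp only [Finset.mem_inter, Finset.mem_singleton, Finset.mem_sdiff, Finset.mem_insert,
            Finset.notMem_empty, iff_false]
          rintro ⟨rfl, -, h⟩
          exact h hvS
        rw [this, cutSum_empty, zero_add]
      · rcases hvS with rfl | rfl
        · simpa using hfg.symm
        · simpa using hfg
    · have h1 : f e ≠ v := fun h => hvS (Or.inl h.symm)
      have h2 : g e ≠ v := fun h => hvS (Or.inr h.symm)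
      rw [hp.1.degree v (by simp [hv]; tauto)]
      simp [h1, h2]
  · by_cases h : e' = e
    · simp [h, hpe]
    · simpa [Pi.single_eq_of_ne h] using hp.2 e'

theorem convex_matchingPolytope (f g : E → W) (T : Finset W) :
    Convex ℝ (matchingPolytope f g T) := by
  intro z hz z' hz' a b ha hb hab
  refine ⟨⟨fun e => ?_, fun e he => ?_, fun v hv => ?_⟩, fun S hS => ?_⟩
  · exact add_nonneg (mul_nonneg ha (hz.1.nonneg e)) (mul_nonneg hb (hz'.1.nonneg e))
  · by_cases h : z e = 0
    · refine hz'.1.supp e fun h' => he ?_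
      simp [h, h']
    · exact hz.1.supp e h
  · rw [cutSum_add, cutSum_smul, cutSum_smul, hz.1.degree v hv, hz'.1.degree v hv]
    linarith
  · rw [cutSum_add, cutSum_smul, cutSum_smul]
    nlinarith [hz.2 S hS, hz'.2 S hS]

theorem isCompact_matchingPolytope (f g : E → W) (T : Finset W) :
    IsCompact (matchingPolytope f g T) := by
  refine (isCompact_Icc (a := (0 : E → ℝ)) (b := 1)).of_isClosed_subset ?_
    fun z hz => ⟨hz.1.nonneg, hz.1.le_one⟩
  have : matchingPolytope f g T =
      (⋂ e, {z | 0 ≤ z e}) ∩ (⋂ e, ⋂ (_ : ¬ (f e ≠ g e ∧ f e ∈ T ∧ g e ∈ T)), {z | z e = 0}) ∩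
      (⋂ v ∈ T, {z | cutSum f g z {v} = 1}) ∩
      (⋂ S : Finset W, ⋂ (_ : Odd (S ∩ T).card), {z | 1 ≤ cutSum f g z S}) := by
    ext z
    simp only [Set.mem_inter_iff, Set.mem_iInter, Set.mem_ofPred_eq]
    constructor
    · rintro ⟨⟨h1, h2, h3⟩, h4⟩
      exact ⟨⟨⟨h1, fun e he => by_contra fun h => he (h2 e h)⟩, h3⟩, h4⟩
    · rintro ⟨⟨⟨h1, h2⟩, h3⟩, h4⟩
      exact ⟨⟨h1, fun e he => by_contra fun h => he (h2 e h), h3⟩, h4⟩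
  rw [this]
  refine IsClosed.inter (IsClosed.inter (IsClosed.inter ?_ ?_) ?_) ?_
  · exact isClosed_iInter fun e => isClosed_le continuous_const (continuous_apply e)
  · exact isClosed_iInter fun e => isClosed_iInter fun _ =>
      isClosed_eq (continuous_apply e) continuous_const
  · exact isClosed_iInter fun v => isClosed_iInter fun _ =>
      isClosed_eq (continuous_cutSum f g _) continuous_const
  · exact isClosed_iInter fun S => isClosed_iInter fun _ =>
      isClosed_le continuous_const (continuous_cutSum f g _)

theorem finite_perfectMatchings (f g : E → W) (T : Finset W) :
    (perfectMatchings f g T).Finite :=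
  (Set.Finite.pi' fun _ : E => Set.toFinite ({0, 1} : Set ℝ)).subset fun _ hp e => hp.2 e

/-- At an extreme point without nontrivial tight odd cuts, the support edges are linearly
independent. -/
theorem eq_zero_of_mem_extremePoints {f g : E → W} {T : Finset W} {z : E → ℝ}
    (hz : z ∈ (matchingPolytope f g T).extremePoints ℝ)
    (hnt : ∀ S : Finset W, Odd (S ∩ T).card → 3 ≤ (S ∩ T).card → 3 ≤ (T \ S).card →
      cutSum f g z S ≠ 1)
    {d : E → ℝ} (hsupp : ∀ e, d e ≠ 0 → z e ≠ 0) (hd : ∀ v ∈ T, cutSum f g d {v} = 0) :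
    d = 0 := by
  -- `z` can be moved along `d` in both directions: zero entries and degrees are kept exactly, and
  -- every other constraint is either strict at `z` or equivalent to a degree equation. There are
  -- finitely many constraints, so a common `ε` exists, and extremality forces `ε • d = 0`.
  have hzK := hz.1
  have hev := even_card_of_mem_matchingPolytope hzK
  have hsupp' : ∀ ε : ℝ, ∀ e, (z + ε • d) e ≠ 0 → f e ≠ g e ∧ f e ∈ T ∧ g e ∈ T := by
    intro ε e he
    refine hzK.1.supp e fun h => he ?_
    have : d e = 0 := by_contra fun h' => hsupp e h' h
    simp [h, this]
  have hdeg : ∀ ε : ℝ, ∀ v ∈ T, cutSum f g (z + ε • d) {v} = 1 := by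
    intro ε v hv
    rw [cutSum_add, cutSum_smul, hd v hv, hzK.1.degree v hv]
    simp
  have hnn : ∀ e, ∀ᶠ ε : ℝ in nhds 0, 0 ≤ (z + ε • d) e := by
    intro e
    by_cases h : z e = 0
    · have : d e = 0 := by_contra fun h' => hsupp e h' h
      simp [h, this]
    · have hc : Filter.Tendsto (fun ε : ℝ => z e + ε * d e) (nhds 0) (nhds (z e + 0 * d e)) :=
        (continuous_const.add (continuous_id.mul continuous_const)).tendsto 0
      have h0 : 0 < z e + 0 * d e := by
        simpa using lt_of_le_of_ne (hzK.1.nonneg e) (Ne.symm h)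
      filter_upwards [hc.eventually_const_lt h0] with ε hε
      exact hε.le
  have hodd : ∀ S : Finset W, ∀ᶠ ε : ℝ in nhds 0,
      Odd (S ∩ T).card → 1 ≤ cutSum f g (z + ε • d) S := by
    intro S
    by_cases hS : Odd (S ∩ T).card
    swap
    · exact Filter.Eventually.of_forall fun ε h => absurd h hS
    have hcard : (S ∩ T).card + (T \ S).card = T.card := by
      rw [Finset.inter_comm]
      exact Finset.card_inter_add_card_sdiff T S
    have hS' : Odd (T \ S).card := by
      obtain ⟨k, hk⟩ := hev
      obtain ⟨j, hj⟩ := hS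
      exact ⟨k - j - 1, by omega⟩
    -- A set with one vertex of `T` on one side gives a degree equation. In all other cases parity
    -- leaves at least three vertices on each side, where `hnt` makes the constraint strict.
    by_cases h1 : (S ∩ T).card = 1
    · obtain ⟨v, hv⟩ := Finset.card_eq_one.1 h1
      refine Filter.Eventually.of_forall fun ε _ => ?_
      rw [← cutSum_inter_of_supp (hsupp' ε), hv, hdeg]
      exact (Finset.mem_inter.1 (hv ▸ Finset.mem_singleton_self v)).2
    by_cases h2 : (T \ S).card = 1
    · obtain ⟨v, hv⟩ := Finset.card_eq_one.1 h2
      have hv' : Sᶜ ∩ T = {v} := by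
        rw [← hv]; ext w; simp [and_comm]
      refine Filter.Eventually.of_forall fun ε _ => ?_
      rw [← cutSum_compl, ← cutSum_inter_of_supp (hsupp' ε), hv', hdeg]
      exact (Finset.mem_sdiff.1 (hv ▸ Finset.mem_singleton_self v)).1
    have h3 : 1 < cutSum f g z S := by
      refine lt_of_le_of_ne (hzK.2 S hS) (Ne.symm (hnt S hS ?_ ?_))
      · obtain ⟨k, hk⟩ := hS; omega
      · obtain ⟨k, hk⟩ := hS'; omega
    have hc : Filter.Tendsto (fun ε : ℝ => cutSum f g z S + ε * cutSum f g d S) (nhds 0)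
        (nhds (cutSum f g z S + 0 * cutSum f g d S)) :=
      (continuous_const.add (continuous_id.mul continuous_const)).tendsto 0
    filter_upwards [hc.eventually_const_lt (by simpa using h3)] with ε hε _
    rw [cutSum_add, cutSum_smul]
    exact hε.le
  have hall : ∀ᶠ ε : ℝ in nhds 0, z + ε • d ∈ matchingPolytope f g T := by
    filter_upwards [Filter.eventually_all.2 hnn, Filter.eventually_all.2 hodd] with ε h1 h2
    exact ⟨⟨h1, hsupp' ε, hdeg ε⟩, h2⟩
  have hneg : ∀ᶠ ε : ℝ in nhds 0, z + (-ε) • d ∈ matchingPolytope f g T := by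
    have : Filter.Tendsto (fun ε : ℝ => -ε) (nhds 0) (nhds 0) := by
      simpa using (continuous_neg.tendsto (0 : ℝ))
    exact this.eventually hall
  obtain ⟨ε, ⟨h1, h2⟩, hε⟩ := ((((hall.and hneg).filter_mono nhdsWithin_le_nhds).and
    self_mem_nhdsWithin : ∀ᶠ ε : ℝ in nhdsWithin 0 (Set.Ioi 0), _)).exists
  have hε : (0 : ℝ) < ε := hε
  have hmem : z ∈ openSegment ℝ (z + ε • d) (z + (-ε) • d) :=
    ⟨1 / 2, 1 / 2, by norm_num, by norm_num, by norm_num, by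
      ext e
      simp
      ring⟩
  have := hz.2 h1 h2 hmem
  have h0 : ε • d = 0 := by simpa using this
  exact (smul_eq_zero.1 h0).resolve_left hε.ne'

end ExtremePoints

/-! ### Edmonds' perfect matching polytope theorem. -/

section MatchingPolytope

set_option linter.unusedSectionVars false

variable {E W : Type*} [Fintype E] [DecidableEq W] [Fintype W]

/-- The map that sends an edge vector supported on `F` to its vector of degrees on `T`. -/
noncomputable def degreeMap (f g : E → W) (T : Finset W) (F : Set E) :
    (F → ℝ) →ₗ[ℝ] (T → ℝ) where
  toFun d v := cutSum f g (Function.ExtendByZero.linearMap ℝ (Subtype.val : F → E) d) {v.1}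
  map_add' d d' := by
    ext v
    rw [map_add, cutSum_add]
    rfl
  map_smul' c d := by
    ext v
    rw [map_smul, cutSum_smul]
    rfl

/-- A dimension count. At an extreme point without nontrivial tight cuts no such vector exists on
the support, so the support has at most as many edges as `T` has vertices. -/
theorem exists_degree_eq_zero (f g : E → W) (T : Finset W) (F : Finset E) (h : T.card < F.card) :
    ∃ d : E → ℝ, d ≠ 0 ∧ (∀ e, d e ≠ 0 → e ∈ F) ∧ ∀ v ∈ T, cutSum f g d {v} = 0 := by
  have hk : LinearMap.ker (degreeMap f g T (F : Set E)) ≠ ⊥ := by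
    apply LinearMap.ker_ne_bot_of_finrank_lt
    simpa using h
  obtain ⟨d, hd, hd0⟩ := (Submodule.ne_bot_iff _).1 hk
  refine ⟨Function.ExtendByZero.linearMap ℝ (Subtype.val : ((F : Set E) : Type _) → E) d,
    fun h0 => hd0 ?_, fun e he => ?_, fun v hv => ?_⟩
  · ext e
    have := congrFun h0 e.1
    simpa [Function.ExtendByZero.linearMap, Subtype.val_injective.extend_apply] using this
  · by_contra hne
    refine he ?_
    refine (Function.extend_apply' d (0 : E → ℝ) e ?_ : Function.extend Subtype.val d 0 e = 0)
    rintro ⟨a, rfl⟩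
    exact hne a.2
  · exact congrFun (LinearMap.mem_ker.1 hd) ⟨v, hv⟩

/-- If every vertex of `T` has at least three incident edges in `F`, all with ends in `T`, then `F`
is larger than `T`. -/
theorem card_lt_card_of_three_le {f g : E → W} {T : Finset W} {F : Finset E} (hT : T.Nonempty)
    (h3 : ∀ v ∈ T, 3 ≤ (F.filter fun e => ¬ (f e ∈ ({v} : Finset W) ↔ g e ∈ ({v} : Finset W))).card) :
    T.card < F.card := by
  -- Double counting: an edge belongs to at most two stars, so `3 |T| ≤ 2 |F|`.
  have h1 : ∑ v ∈ T, (F.filter fun e =>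
      ¬ (f e ∈ ({v} : Finset W) ↔ g e ∈ ({v} : Finset W))).card ≤ 2 * F.card := by
    simp only [Finset.card_filter]
    rw [Finset.sum_comm, mul_comm, ← smul_eq_mul, ← Finset.sum_const]
    refine Finset.sum_le_sum fun e he => ?_
    rw [← Finset.card_filter]
    calc _ ≤ ({f e, g e} : Finset W).card := by
          refine Finset.card_le_card fun v hv => ?_
          simp only [Finset.mem_filter, Finset.mem_singleton] at hv
          simp only [Finset.mem_insert, Finset.mem_singleton]
          by_contra h
          push Not at h
          exact hv.2 ⟨fun h' => absurd h'.symm h.1, fun h' => absurd h'.symm h.2⟩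
      _ ≤ 2 := Finset.card_le_two
  have h2 := Finset.sum_le_sum h3
  rw [Finset.sum_const, smul_eq_mul] at h2
  have := hT.card_pos
  omega

/-- An extreme point of the matching polytope of a nonempty vertex set has an edge of value one or
a nontrivial tight odd cut. -/
theorem exists_eq_one_or_tight {f g : E → W} {T : Finset W} {z : E → ℝ} (hT : T.Nonempty)
    (hz : z ∈ (matchingPolytope f g T).extremePoints ℝ) :
    (∃ e, z e = 1) ∨ ∃ S : Finset W, Odd (S ∩ T).card ∧ 3 ≤ (S ∩ T).card ∧ 3 ≤ (T \ S).card ∧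
      cutSum f g z S = 1 := by
  classical
  -- Otherwise the support has at most `|T|` edges, so some vertex `b` has exactly two support
  -- edges, to `a` and `c`. The set `{a, b, c}` is then tight, which leaves room for only one
  -- further vertex `x`. The support contains the 4-cycle b, a, x, c, and the alternating vector of
  -- this cycle has all degrees zero, which contradicts `hker`.
  by_contra! hcon
  obtain ⟨h1, hnt⟩ := hcon
  have hzK := hz.1
  have hker : ∀ d : E → ℝ, (∀ e, d e ≠ 0 → z e ≠ 0) → (∀ v ∈ T, cutSum f g d {v} = 0) → d = 0 :=
    fun d => eq_zero_of_mem_extremePoints hz hnt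
  set F : Finset E := Finset.univ.filter fun e => z e ≠ 0 with hFdef
  have hFT : F.card ≤ T.card := by
    by_contra! h
    obtain ⟨d, hd0, hdF, hd⟩ := exists_degree_eq_zero f g T F h
    exact hd0 (hker d (fun e he => (Finset.mem_filter.1 (hdF e he)).2) hd)
  obtain ⟨b, hb, hb3⟩ : ∃ b ∈ T, (F.filter fun e =>
      ¬ (f e ∈ ({b} : Finset W) ↔ g e ∈ ({b} : Finset W))).card < 3 := by
    by_contra h
    exact absurd (card_lt_card_of_three_le hT
      fun v hv => not_lt.1 fun hlt => h ⟨v, hv, hlt⟩) (by omega)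
  -- the two support edges at `b`
  obtain ⟨e1, e2, hne, he1, he2, hb1, hb2, honly⟩ : ∃ e1 e2, e1 ≠ e2 ∧ z e1 ≠ 0 ∧ z e2 ≠ 0 ∧
      ¬ (f e1 ∈ ({b} : Finset W) ↔ g e1 ∈ ({b} : Finset W)) ∧
      ¬ (f e2 ∈ ({b} : Finset W) ↔ g e2 ∈ ({b} : Finset W)) ∧
      ∀ e, z e ≠ 0 → ¬ (f e ∈ ({b} : Finset W) ↔ g e ∈ ({b} : Finset W)) → e = e1 ∨ e = e2 := by
    obtain ⟨e0, -⟩ : ∃ e0 : E, True := by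
      by_contra! h
      have h2 := hzK.1.degree b hb
      unfold cutSum at h2
      rw [Finset.sum_eq_zero fun e _ => (h e).elim] at h2
      norm_num at h2
    obtain ⟨e1, -, he1, hb1⟩ := hzK.1.exists_other hb e0 (h1 e0)
    obtain ⟨e2, hne, he2, hb2⟩ := hzK.1.exists_other hb e1 (h1 e1)
    refine ⟨e1, e2, hne.symm, he1, he2, hb1, hb2, fun e he hbe => ?_⟩
    by_contra! h
    have hsub : ({e, e1, e2} : Finset E) ⊆ F.filter fun e =>
        ¬ (f e ∈ ({b} : Finset W) ↔ g e ∈ ({b} : Finset W)) := by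
      intro i hi
      simp only [Finset.mem_insert, Finset.mem_singleton] at hi
      rcases hi with rfl | rfl | rfl <;> simp only [hFdef, Finset.mem_filter, Finset.mem_univ,
        true_and]
      exacts [⟨he, hbe⟩, ⟨he1, hb1⟩, ⟨he2, hb2⟩]
    have := Finset.card_le_card hsub
    rw [Finset.card_eq_three.2 ⟨e, e1, e2, h.1, h.2, hne.symm, rfl⟩] at this
    omega
  obtain ⟨a, hab, hea⟩ := exists_sym2_eq_of_mem_cut hb1
  obtain ⟨c, hcb, hec⟩ := exists_sym2_eq_of_mem_cut hb2
  have ha := (hzK.1.mem_of_sym2_eq he1 hea).2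
  have hc := (hzK.1.mem_of_sym2_eq he2 hec).2
  -- Two parallel support edges would differ by a nonzero vector with all degrees zero.
  have hac : a ≠ c := by
    rintro rfl
    have h0 := hker (Pi.single e1 1 - Pi.single e2 1) (fun e he => ?_) (fun v _ => ?_)
    · have := congrFun h0 e1
      simp [Pi.single_eq_of_ne hne] at this
    · by_cases h : e = e1
      · rwa [h]
      by_cases h' : e = e2
      · rwa [h']
      simp [Pi.single_eq_of_ne h, Pi.single_eq_of_ne h'] at he
    · rw [cutSum_sub, cutSum_single, cutSum_single]
      simp only [mem_iff_mem_of_sym2_eq hea, mem_iff_mem_of_sym2_eq hec, sub_self]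
  have hz12 : z e1 + z e2 = 1 := by
    rw [← hzK.1.degree b hb, ← Finset.sum_pair hne]
    unfold cutSum
    rw [← Finset.sum_subset (Finset.subset_univ {e1, e2})]
    · rw [Finset.sum_pair hne, Finset.sum_pair hne, if_neg hb1, if_neg hb2]
    · intro e _ he
      split_ifs with h
      · rfl
      · by_contra h0
        exact he (by simpa using honly e h0 h)
  set S : Finset W := {a, b, c} with hS
  have hST : S ⊆ T := by
    intro w hw
    simp only [hS, Finset.mem_insert, Finset.mem_singleton] at hw
    rcases hw with rfl | rfl | rfl <;> assumption
  have hS3 : (S ∩ T).card = 3 := by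
    rw [Finset.inter_eq_left.2 hST]
    exact Finset.card_eq_three.2 ⟨a, b, c, hab, hac, hcb.symm, rfl⟩
  have hSodd : Odd (S ∩ T).card := by rw [hS3]; decide
  -- pointwise comparison of the cut of `S` with the cuts of `a` and `c`
  let u : E → ℝ := fun e => (if (f e ∈ S ↔ g e ∈ S) then 0 else z e) +
    ((if e = e1 then z e else 0) + (if e = e2 then z e else 0))
  let u' : E → ℝ := fun e =>
    (if (f e ∈ ({a} : Finset W) ↔ g e ∈ ({a} : Finset W)) then 0 else z e) +
    (if (f e ∈ ({c} : Finset W) ↔ g e ∈ ({c} : Finset W)) then 0 else z e)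
  have huu' : ∀ e ∈ Finset.univ, u e ≤ u' e := by
    intro e _
    by_cases he : z e = 0
    · simp [u, u', he]
    by_cases h : e = e1
    · subst h
      simp only [u, u', mem_iff_mem_of_sym2_eq hea]
      simp [hS, hab.symm, hcb.symm, hne, hac]
    by_cases h' : e = e2
    · subst h'
      simp only [u, u', mem_iff_mem_of_sym2_eq hec]
      simp [hS, hab.symm, hcb.symm, hne.symm, hac.symm]
    have hbe : f e ∈ ({b} : Finset W) ↔ g e ∈ ({b} : Finset W) := by
      by_contra h''
      rcases honly e he h'' with h'' | h'' <;> contradiction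
    simp only [Finset.mem_singleton] at hbe
    have hnn := hzK.1.nonneg e
    have hfg := (hzK.1.supp e he).1
    have hfb : f e ≠ b := fun hf => hfg (hf.trans (hbe.1 hf).symm)
    have hgb : g e ≠ b := fun hg => hfg ((hbe.2 hg).trans hg.symm)
    simp only [u, u', h, h', if_false, hS, Finset.mem_insert, Finset.mem_singleton, hfb, hgb,
      false_or]
    by_cases x1 : f e = a <;> by_cases x2 : g e = a <;> by_cases x3 : f e = c <;>
      by_cases x4 : g e = c <;> simp [x1, x2, x3, x4] <;> split_ifs <;> linarith
  have hsu : ∑ e, u e = cutSum f g z S + 1 := by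
    simp only [u, Finset.sum_add_distrib, Finset.sum_ite_eq', Finset.mem_univ, if_true, hz12]
    rfl
  have hsu' : ∑ e, u' e = 2 := by
    simp only [u', Finset.sum_add_distrib]
    have h2 := hzK.1.degree a ha
    have h3 := hzK.1.degree c hc
    unfold cutSum at h2 h3
    rw [h2, h3]
    norm_num
  have hge := hzK.2 S hSodd
  have hle := Finset.sum_le_sum huu'
  -- The comparison reads cut(S) + 1 ≤ 2, while cut(S) ≥ 1, so equality holds for each edge. This
  -- excludes support edges between `a` and `c`, which `u'` counts twice and `u` not at all.
  have hS1 : cutSum f g z S = 1 := by linarith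
  have hpt := (Finset.sum_eq_sum_iff_of_le huu').1 (by linarith)
  have hTS : (T \ S).card = 1 := by
    have hcard : (S ∩ T).card + (T \ S).card = T.card := by
      rw [Finset.inter_comm]
      exact Finset.card_inter_add_card_sdiff T S
    obtain ⟨k, hk⟩ := even_card_of_mem_matchingPolytope hzK
    have h3 : ¬ 3 ≤ (T \ S).card := fun h => hnt S hSodd (by omega) h hS1
    omega
  obtain ⟨x, hx⟩ := Finset.card_eq_one.1 hTS
  have hxm : x ∈ T \ S := hx ▸ Finset.mem_singleton_self x
  have hxS : x ∉ S := (Finset.mem_sdiff.1 hxm).2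
  simp only [hS, Finset.mem_insert, Finset.mem_singleton, not_or] at hxS
  obtain ⟨hxa, hxb, hxc⟩ := hxS
  -- The support edge at `v` other than its edge `e0` to `b` leads neither to `b` nor to the other
  -- neighbour `v'` of `b`; only `x` is left.
  have hother : ∀ (v v' : W) (e0 : E), v ∈ T → v ≠ b → (v = a ∧ v' = c ∨ v = c ∧ v' = a) →
      (∀ e, e = e1 ∨ e = e2 → e ≠ e0 → ¬ ¬ (f e ∈ ({v} : Finset W) ↔ g e ∈ ({v} : Finset W))) →
      ∃ e, z e ≠ 0 ∧ s(f e, g e) = s(v, x) := by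
    intro v v' e0 hv hvb hvv' h0
    obtain ⟨e, hne0, he, hve⟩ := hzK.1.exists_other hv e0 (h1 e0)
    obtain ⟨o, hov, heo⟩ := exists_sym2_eq_of_mem_cut hve
    have hoT := (hzK.1.mem_of_sym2_eq he heo).2
    have hn12 : ¬ (e = e1 ∨ e = e2) := fun h => h0 e h hne0 hve
    have hob : o ≠ b := by
      rintro rfl
      refine hn12 (honly e he ?_)
      rw [mem_iff_mem_of_sym2_eq heo]
      simp [hvb]
    have hov' : o ≠ v' := by
      intro ho
      have := hpt e (Finset.mem_univ _)
      push Not at hn12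
      simp only [u, u', mem_iff_mem_of_sym2_eq heo, hn12.1, hn12.2, if_false, ho] at this
      rcases hvv' with ⟨rfl, rfl⟩ | ⟨rfl, rfl⟩
      · simp [hS, hac, hac.symm] at this
        exact he (by linarith)
      · simp [hS, hac, hac.symm] at this
        exact he (by linarith)
    have hox : o = x := by
      have : o ∈ T \ S := by
        simp only [hS, Finset.mem_sdiff, hoT, Finset.mem_insert, Finset.mem_singleton, true_and]
        rcases hvv' with ⟨rfl, rfl⟩ | ⟨rfl, rfl⟩ <;> tauto
      rw [hx] at this
      simpa using this
    exact ⟨e, he, by rw [heo, hox]⟩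
  obtain ⟨e3, he3, he3'⟩ := hother a c e1 ha hab (Or.inl ⟨rfl, rfl⟩) (by
    rintro e (rfl | rfl) h
    · exact absurd rfl h
    · rw [mem_iff_mem_of_sym2_eq hec]
      simp [hab.symm, hac.symm])
  obtain ⟨e4, he4, he4'⟩ := hother c a e2 hc hcb (Or.inr ⟨rfl, rfl⟩) (by
    rintro e (rfl | rfl) h
    · rw [mem_iff_mem_of_sym2_eq hea]
      simp [hcb.symm, hac]
    · exact absurd rfl h)
  have hcutD : ∀ X : Finset W,
      cutSum f g (Pi.single e1 1 - Pi.single e2 1 + (Pi.single e4 1 - Pi.single e3 1)) X =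
      (if (b ∈ X ↔ a ∈ X) then 0 else 1) - (if (b ∈ X ↔ c ∈ X) then 0 else 1) +
      ((if (c ∈ X ↔ x ∈ X) then 0 else 1) - (if (a ∈ X ↔ x ∈ X) then 0 else 1)) := by
    intro X
    simp only [cutSum_add, cutSum_sub, cutSum_single, mem_iff_mem_of_sym2_eq hea,
      mem_iff_mem_of_sym2_eq hec, mem_iff_mem_of_sym2_eq he3', mem_iff_mem_of_sym2_eq he4']
  have hD0 := hker (Pi.single e1 1 - Pi.single e2 1 + (Pi.single e4 1 - Pi.single e3 1))
    (fun e he => ?_) (fun v hv => ?_)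
  -- The cut of `{a, x}` has value two, because it meets the cycle in `ba` and `cx`, both of sign
  -- plus. So the vector is nonzero, without any comparison of the four edges.
  · have := hcutD {a, x}
    rw [hD0] at this
    have h0 : cutSum f g (0 : E → ℝ) {a, x} = 0 := by simp [cutSum]
    rw [h0] at this
    simp [hab.symm, hac.symm, Ne.symm hxb, Ne.symm hxc] at this
    norm_num at this
  · by_cases x1 : e = e1
    · rwa [x1]
    by_cases x2 : e = e2
    · rwa [x2]
    by_cases x3 : e = e3
    · rwa [x3]
    by_cases x4 : e = e4
    · rwa [x4]
    simp [Pi.single_eq_of_ne x1, Pi.single_eq_of_ne x2, Pi.single_eq_of_ne x3,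
      Pi.single_eq_of_ne x4] at he
  · rw [hcutD]
    by_cases hvS : v ∈ S
    · simp only [hS, Finset.mem_insert, Finset.mem_singleton] at hvS
      rcases hvS with rfl | rfl | rfl
      · simp [hab.symm, hac.symm, hxa]
      · simp [hab, hcb, hxb]
      · simp [hcb.symm, hac, hxc]
    · have : v ∈ T \ S := Finset.mem_sdiff.2 ⟨hv, hvS⟩
      rw [hx, Finset.mem_singleton] at this
      subst this
      simp [Ne.symm hxa, Ne.symm hxb, Ne.symm hxc]

/-- **Edmonds' perfect matching polytope theorem.** -/
theorem matchingPolytope_subset_convexHull (f g : E → W) (T : Finset W) :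
    matchingPolytope f g T ⊆ convexHull ℝ (perfectMatchings f g T) := by
  classical
  induction h : T.card using Nat.strong_induction_on generalizing f g T with
  | _ n ih =>
  subst h
  -- By Krein–Milman it suffices to treat extreme points, since the hull of the finitely many
  -- matchings is closed.
  rw [← closure_convexHull_extremePoints (isCompact_matchingPolytope f g T)
    (convex_matchingPolytope f g T)]
  refine closure_minimal (convexHull_min (fun z hz => ?_) (convex_convexHull ℝ _))
    ((finite_perfectMatchings f g T).isClosed_convexHull ℝ)
  have hzK := hz.1
  rcases T.eq_empty_or_nonempty with rfl | hT
  · refine subset_convexHull ℝ _ ⟨hzK.1, fun e => Or.inl ?_⟩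
    by_contra h
    simpa using (hzK.1.supp e h).2.1
  -- An edge of value one is removed together with its ends; for a tight odd cut both sides are
  -- contracted in turn. Having at least three vertices of `T` on each side makes both contractions
  -- smaller.
  rcases exists_eq_one_or_tight hT hz with ⟨e, he⟩ | ⟨S, hodd, h3, h3', hS⟩
  · obtain ⟨hfg, hf, hg⟩ := hzK.1.supp e (by simp [he])
    have h1 := ih _ (Finset.card_lt_card (Finset.sdiff_ssubset
      (Finset.insert_subset hf (Finset.singleton_subset_iff.2 hg)) ⟨f e, by simp⟩)) f g _ rfl
      (sub_single_mem_matchingPolytope hzK he)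
    have h2 : convexHull ℝ (perfectMatchings f g (T \ {f e, g e})) ⊆
        (fun p => p + Pi.single e 1) ⁻¹' convexHull ℝ (perfectMatchings f g T) := by
      refine convexHull_min (𝕜 := ℝ) (fun p hp => subset_convexHull ℝ _
        (add_single_mem_perfectMatchings hfg hf hg hp)) ?_
      exact (convex_convexHull ℝ _).translate_preimage_left _
    have := h2 h1
    simpa using this
  · have hodd' : Odd (Sᶜ ∩ T).card := by
      have hcard := Finset.card_inter_add_card_sdiff T S
      have : Sᶜ ∩ T = T \ S := by ext w; simp [and_comm]
      rw [this]
      rw [Finset.inter_comm] at hcard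
      obtain ⟨k, hk⟩ := even_card_of_mem_matchingPolytope hzK
      obtain ⟨j, hj⟩ := hodd
      exact ⟨k - j - 1, by omega⟩
    obtain ⟨s, hs⟩ := Finset.card_pos.1 (show 0 < (S ∩ T).card by omega)
    obtain ⟨t, ht⟩ := Finset.card_pos.1 (show 0 < (T \ S).card by omega)
    have hs := (Finset.mem_inter.1 hs).1
    have ht : t ∈ Sᶜ := by simpa using (Finset.mem_sdiff.1 ht).2
    have hc1 : (insert s (T \ S)).card < T.card := by
      have hcard := Finset.card_inter_add_card_sdiff T S
      rw [Finset.inter_comm] at hcard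
      have := Finset.card_insert_le s (T \ S)
      omega
    have hc2 : (insert t (T \ Sᶜ)).card < T.card := by
      have hcard := Finset.card_inter_add_card_sdiff T S
      have h2 : T \ Sᶜ = S ∩ T := by ext w; simp [and_comm]
      rw [Finset.inter_comm] at hcard
      have := Finset.card_insert_le t (T \ Sᶜ)
      rw [h2] at this ⊢
      omega
    exact mem_convexHull_of_glue hzK hs ht
      (ih _ hc1 _ _ _ rfl (contract_mem_matchingPolytope hzK hs hodd hS))
      (ih _ hc2 _ _ _ rfl (contract_mem_matchingPolytope hzK ht hodd' (by rwa [cutSum_compl])))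

end MatchingPolytope

/-! ### From cut constraints to perfect matchings by splitting off. -/

section SplittingOff

theorem cutSum_inter_add_cutSum_union_le {E W : Type*} [Fintype E] [DecidableEq W] {f g : E → W}
    {z : E → ℝ} (hz : ∀ e, 0 ≤ z e) (X Y : Finset W) :
    cutSum f g z (X ∩ Y) + cutSum f g z (X ∪ Y) ≤ cutSum f g z X + cutSum f g z Y := by
  unfold cutSum
  rw [← Finset.sum_add_distrib, ← Finset.sum_add_distrib]
  refine Finset.sum_le_sum fun e _ => ?_
  have := hz e
  simp only [Finset.mem_inter, Finset.mem_union]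
  by_cases h1 : f e ∈ X <;> by_cases h2 : g e ∈ X <;> by_cases h3 : f e ∈ Y <;>
    by_cases h4 : g e ∈ Y <;> simp [h1, h2, h3, h4, this]

/-- The edge `e₀` joins `X ∩ Y` to the outside of `X ∪ Y`. It lies in both cuts on the right and in
neither of the difference cuts, which gives the surplus `2 * z e₀`. -/
theorem cutSum_sdiff_add_cutSum_sdiff_le {E W : Type*} [Fintype E] [DecidableEq W] {f g : E → W}
    {z : E → ℝ} (hz : ∀ e, 0 ≤ z e) (X Y : Finset W) {e₀ : E} {v a : W}
    (he : s(f e₀, g e₀) = s(v, a)) (haX : a ∈ X) (haY : a ∈ Y) (hvX : v ∉ X) (hvY : v ∉ Y) :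
    cutSum f g z (X \ Y) + cutSum f g z (Y \ X) + 2 * z e₀ ≤ cutSum f g z X + cutSum f g z Y := by
  classical
  have h0 : 2 * z e₀ = ∑ e, if e = e₀ then 2 * z e else 0 := by simp
  unfold cutSum
  rw [h0, ← Finset.sum_add_distrib, ← Finset.sum_add_distrib, ← Finset.sum_add_distrib]
  refine Finset.sum_le_sum fun e _ => ?_
  have := hz e
  by_cases hee : e = e₀
  · subst hee
    simp only [mem_iff_mem_of_sym2_eq he]
    simp [haX, haY, hvX, hvY]
    linarith
  · simp only [Finset.mem_sdiff, hee, if_false, add_zero]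
    by_cases h1 : f e ∈ X <;> by_cases h2 : g e ∈ X <;> by_cases h3 : f e ∈ Y <;>
      by_cases h4 : g e ∈ Y <;> simp [h1, h2, h3, h4, this]

variable {V : Type*}

/-- The first end of an unordered pair, in an arbitrary order. -/
noncomputable def fstEnd (e : Sym2 V) : V := (Quot.out e).1

/-- The second end of an unordered pair, in an arbitrary order. -/
noncomputable def sndEnd (e : Sym2 V) : V := (Quot.out e).2

theorem mk_ends (e : Sym2 V) : s(fstEnd e, sndEnd e) = e := Quot.out_eq e

variable [Fintype V] [DecidableEq V]

/-- The total weight of the cut of `S` in the complete graph. -/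
noncomputable abbrev pairCut (z : Sym2 V → ℝ) (S : Finset V) : ℝ := cutSum fstEnd sndEnd z S

/-- The edge vectors with nonnegative entries that satisfy all `Q`-cut constraints and have total
weight at most `A` and cost at most `B`. -/
def joinRegion (Q : Finset V) (d : Sym2 V → ℝ) (A B : ℝ) : Set (Sym2 V → ℝ) :=
  {z | (∀ e, 0 ≤ z e) ∧ (∀ S : Finset V, Odd (S ∩ Q).card → 1 ≤ pairCut z S) ∧
    ∑ e, z e ≤ A ∧ ∑ e, d e * z e ≤ B}

theorem isCompact_joinRegion (Q : Finset V) (d : Sym2 V → ℝ) (A B : ℝ) :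
    IsCompact (joinRegion Q d A B) := by
  refine (isCompact_Icc (a := (0 : Sym2 V → ℝ)) (b := fun _ => A)).of_isClosed_subset ?_
    fun z hz => ⟨hz.1, fun e =>
      (Finset.single_le_sum (fun i _ => hz.1 i) (Finset.mem_univ e)).trans hz.2.2.1⟩
  have : joinRegion Q d A B = (⋂ e, {z | 0 ≤ z e}) ∩
      (⋂ S : Finset V, ⋂ (_ : Odd (S ∩ Q).card), {z | 1 ≤ pairCut z S}) ∩
      {z | ∑ e, z e ≤ A} ∩ {z | ∑ e, d e * z e ≤ B} := by
    ext z
    simp only [joinRegion, Set.mem_inter_iff, Set.mem_iInter, Set.mem_ofPred_eq]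
    tauto
  rw [this]
  refine IsClosed.inter (IsClosed.inter (IsClosed.inter ?_ ?_) ?_) ?_
  · exact isClosed_iInter fun e => isClosed_le continuous_const (continuous_apply e)
  · exact isClosed_iInter fun S => isClosed_iInter fun _ =>
      isClosed_le continuous_const (continuous_cutSum _ _ _)
  · exact isClosed_le (continuous_finsetSum _ fun e _ => continuous_apply e) continuous_const
  · exact isClosed_le
      (continuous_finsetSum _ fun e _ => continuous_const.mul (continuous_apply e)) continuous_const

/-- In a point of minimum total weight, no pair of edges can be split off. -/
theorem not_forall_lt_of_isMinOn {Q : Finset V} {d : Sym2 V → ℝ} {A B : ℝ} {w : Sym2 V → ℝ}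
    (hw : w ∈ joinRegion Q d A B)
    (hmin : IsMinOn (fun z : Sym2 V → ℝ => ∑ e, z e) (joinRegion Q d A B) w)
    (hQ : Even Q.card) {v a b : V} (hd : d s(a, b) ≤ d s(v, a) + d s(v, b))
    (hwa : 0 < w s(v, a)) (hwb : 0 < w s(v, b)) :
    ∃ Y : Finset V, a ∈ Y ∧ b ∈ Y ∧ v ∉ Y ∧ Odd (Y ∩ Q).card ∧ pairCut w Y ≤ 1 := by
  -- If all these odd sets are slack, a small amount can be moved from `va` and `vb` to `ab`. The
  -- cost does not rise, by `hd`, but the total weight drops. For `a = b` the weight goes to a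
  -- diagonal pair, which lies in no cut.
  by_contra! hcon
  obtain ⟨hw0, hwodd, hwA, hwB⟩ := hw
  set D : Sym2 V → ℝ := Pi.single s(a, b) 1 - Pi.single s(v, a) 1 - Pi.single s(v, b) 1 with hD
  have hsum : ∑ e, D e = -1 := by
    simp [hD, Finset.sum_sub_distrib]
  have hcost : ∑ e, d e * D e ≤ 0 := by
    have : ∑ e, d e * D e = d s(a, b) - d s(v, a) - d s(v, b) := by
      simp [hD, mul_sub, Finset.sum_sub_distrib, Pi.single_apply]
    linarith
  have hcutD : ∀ Y : Finset V, pairCut D Y = (if (a ∈ Y ↔ b ∈ Y) then 0 else 1) -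
      (if (v ∈ Y ↔ a ∈ Y) then 0 else 1) - (if (v ∈ Y ↔ b ∈ Y) then 0 else 1) := by
    intro Y
    simp only [hD, pairCut, cutSum_sub, cutSum_single, mem_iff_mem_of_sym2_eq (mk_ends _)]
  have hnn : ∀ e, ∀ᶠ ε : ℝ in nhdsWithin 0 (Set.Ioi 0), 0 ≤ (w + ε • D) e := by
    intro e
    by_cases h : w e = 0
    · have h1 : e ≠ s(v, a) := fun h' => by rw [← h', h] at hwa; exact lt_irrefl _ hwa
      have h2 : e ≠ s(v, b) := fun h' => by rw [← h', h] at hwb; exact lt_irrefl _ hwb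
      have h3 : 0 ≤ D e := by
        simp only [hD, Pi.sub_apply, Pi.single_eq_of_ne h1, Pi.single_eq_of_ne h2, sub_zero,
          Pi.single_apply]
        split_ifs <;> norm_num
      filter_upwards [self_mem_nhdsWithin] with ε hε
      have hε : (0 : ℝ) < ε := hε
      simp only [Pi.add_apply, Pi.smul_apply, smul_eq_mul, h, zero_add]
      positivity
    · have hc : Filter.Tendsto (fun ε : ℝ => w e + ε * D e) (nhds 0) (nhds (w e + 0 * D e)) :=
        (continuous_const.add (continuous_id.mul continuous_const)).tendsto 0
      have h0 : 0 < w e + 0 * D e := by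
        simpa using lt_of_le_of_ne (hw0 e) (Ne.symm h)
      filter_upwards [(hc.eventually_const_lt h0).filter_mono nhdsWithin_le_nhds] with ε hε
      exact hε.le
  have hodd' : ∀ S : Finset V, v ∉ S → ∀ᶠ ε : ℝ in nhdsWithin 0 (Set.Ioi 0),
      Odd (S ∩ Q).card → 1 ≤ pairCut (w + ε • D) S := by
    intro S hvS
    by_cases hS : Odd (S ∩ Q).card
    swap
    · exact Filter.Eventually.of_forall fun ε h => absurd h hS
    by_cases hab : a ∈ S ∧ b ∈ S
    · have hc : Filter.Tendsto (fun ε : ℝ => pairCut w S + ε * pairCut D S) (nhds 0)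
          (nhds (pairCut w S + 0 * pairCut D S)) :=
        (continuous_const.add (continuous_id.mul continuous_const)).tendsto 0
      have h0 : 1 < pairCut w S + 0 * pairCut D S := by
        simpa using hcon S hab.1 hab.2 hvS hS
      filter_upwards [(hc.eventually_const_lt h0).filter_mono nhdsWithin_le_nhds] with ε hε _
      rw [pairCut, cutSum_add, cutSum_smul]
      exact hε.le
    · refine Filter.Eventually.of_forall fun ε h => ?_
      have h0 : pairCut D S = 0 := by
        rw [hcutD]
        by_cases h1 : a ∈ S <;> by_cases h2 : b ∈ S <;> simp_all
      rw [pairCut, cutSum_add, cutSum_smul, ← pairCut, ← pairCut, h0, mul_zero, add_zero]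
      exact hwodd S hS
  have hodd : ∀ S : Finset V, ∀ᶠ ε : ℝ in nhdsWithin 0 (Set.Ioi 0),
      Odd (S ∩ Q).card → 1 ≤ pairCut (w + ε • D) S := by
    intro S
    -- As `|Q|` is even, the complement of an odd set is odd, so `v` may be assumed outside.
    by_cases hvS : v ∈ S
    · filter_upwards [hodd' Sᶜ (by simpa using hvS)] with ε h hS
      rw [pairCut, ← cutSum_compl]
      refine h ?_
      have hcard := Finset.card_inter_add_card_sdiff Q S
      have h2 : Sᶜ ∩ Q = Q \ S := by ext x; simp [and_comm]
      rw [h2]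
      rw [Finset.inter_comm] at hcard
      obtain ⟨k, hk⟩ := hQ
      obtain ⟨j, hj⟩ := hS
      exact ⟨k - j - 1, by omega⟩
    · exact hodd' S hvS
  obtain ⟨ε, ⟨h1, h2⟩, hε⟩ := (((Filter.eventually_all.2 hnn).and
    (Filter.eventually_all.2 hodd)).and self_mem_nhdsWithin).exists
  have hε : (0 : ℝ) < ε := hε
  have hs' : ∑ e, (w + ε • D) e = ∑ e, w e - ε := by
    simp only [Pi.add_apply, Pi.smul_apply, smul_eq_mul, Finset.sum_add_distrib,
      ← Finset.mul_sum, hsum]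
    ring
  have hmem : w + ε • D ∈ joinRegion Q d A B := by
    refine ⟨h1, h2, by linarith, ?_⟩
    have : ∑ e, d e * (w + ε • D) e = ∑ e, d e * w e + ε * ∑ e, d e * D e := by
      rw [Finset.mul_sum, ← Finset.sum_add_distrib]
      refine Finset.sum_congr rfl fun e _ => ?_
      simp only [Pi.add_apply, Pi.smul_apply, smul_eq_mul]
      ring
    rw [this]
    nlinarith
  have := hmin hmem
  simp only [Set.mem_ofPred_eq, hs'] at this
  linarith

/-- A point of minimum total weight has degree zero outside of `Q`, and degree at most one on
`Q`. -/
theorem degree_le_of_isMinOn {Q : Finset V} {d : Sym2 V → ℝ} {A B : ℝ} {w : Sym2 V → ℝ}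
    (hw : w ∈ joinRegion Q d A B)
    (hmin : IsMinOn (fun z : Sym2 V → ℝ => ∑ e, z e) (joinRegion Q d A B) w)
    (hQ : Even Q.card) (hd : ∀ v a b, d s(a, b) ≤ d s(v, a) + d s(v, b)) {v a : V} (hav : a ≠ v)
    (hwa : 0 < w s(v, a)) : v ∈ Q ∧ pairCut w {v} ≤ 1 := by
  obtain ⟨hw0, hwodd, -, -⟩ := id hw
  by_contra hcon
  -- The degenerate choice `b = a` provides a tight odd set that contains `a` and avoids `v`; `X` is
  -- a largest one.
  obtain ⟨Y₀, haY₀, -, hvY₀, hY₀, hY₀1⟩ := not_forall_lt_of_isMinOn hw hmin hQ (hd v a a) hwa hwa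
  obtain ⟨X, hX, hXmax⟩ := Finset.exists_max_image
    (Finset.univ.filter fun Y : Finset V => a ∈ Y ∧ v ∉ Y ∧ Odd (Y ∩ Q).card ∧ pairCut w Y ≤ 1)
    Finset.card ⟨Y₀, by simp [haY₀, hvY₀, hY₀, hY₀1]⟩
  simp only [Finset.mem_filter, Finset.mem_univ, true_and] at hX hXmax
  obtain ⟨haX, hvX, hXodd, hX1⟩ := hX
  -- Suppose that all support edges at `v` lead into `X`. If `v ∈ Q`, then the star of `v` is
  -- contained in the tight cut of `X`, so the degree is at most one, against `hcon`. If `v ∉ Q`,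
  -- then adding `v` to `X` keeps the parity and lowers the cut by the positive degree of `v`, to
  -- below one.
  obtain ⟨b, hbv, hbX, hwb⟩ : ∃ b, b ≠ v ∧ b ∉ X ∧ 0 < w s(v, b) := by
    by_contra! h
    have hzero : ∀ e, w e ≠ 0 → ¬ (fstEnd e ∈ ({v} : Finset V) ↔ sndEnd e ∈ ({v} : Finset V)) →
        ∃ b ∈ X, e = s(v, b) := by
      intro e he hve
      obtain ⟨b, hbv, hb⟩ := exists_sym2_eq_of_mem_cut hve
      rw [mk_ends] at hb
      refine ⟨b, ?_, hb⟩
      by_contra hbX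
      exact he (le_antisymm (hb ▸ h b hbv hbX) (hw0 e))
    by_cases hvQ : v ∈ Q
    · refine hcon ⟨hvQ, le_trans (Finset.sum_le_sum fun e _ => ?_) hX1⟩
      by_cases he : w e = 0
      · simp [he]
      by_cases hve : (fstEnd e ∈ ({v} : Finset V) ↔ sndEnd e ∈ ({v} : Finset V))
      · rw [if_pos hve]
        split_ifs
        exacts [le_rfl, hw0 e]
      · obtain ⟨b, hb, rfl⟩ := hzero e he hve
        rw [if_neg hve, if_neg]
        rw [mem_iff_mem_of_sym2_eq (mk_ends _)]
        simp [hb, hvX]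
    · have hodd : Odd (insert v X ∩ Q).card := by
        rwa [Finset.insert_inter_of_notMem hvQ]
      have h1 := hwodd _ hodd
      have h2 : pairCut w (insert v X) + pairCut w {v} ≤ pairCut w X := by
        unfold pairCut cutSum
        rw [← Finset.sum_add_distrib]
        refine Finset.sum_le_sum fun e _ => ?_
        by_cases he : w e = 0
        · simp [he]
        by_cases hve : (fstEnd e ∈ ({v} : Finset V) ↔ sndEnd e ∈ ({v} : Finset V))
        · have hfg : (fstEnd e ∈ insert v X ↔ sndEnd e ∈ insert v X) ↔
              (fstEnd e ∈ X ↔ sndEnd e ∈ X) := by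
            simp only [Finset.mem_singleton] at hve
            simp only [Finset.mem_insert]
            by_cases hf : fstEnd e = v
            · simp [hf, hve.1 hf]
            · have : ¬ sndEnd e = v := fun hg => hf (hve.2 hg)
              simp [hf, this]
          rw [if_pos hve]
          simp only [hfg, add_zero, le_refl]
        · obtain ⟨b, hb, rfl⟩ := hzero e he hve
          have hbv : b ≠ v := fun h => hvX (h ▸ hb)
          simp only [mem_iff_mem_of_sym2_eq (mk_ends _)]
          simp [hb, hvX, hbv]
      have h3 : w s(v, a) ≤ pairCut w {v} := by
        have := sum_le_cutSum (f := fstEnd) (g := sndEnd) hw0 (S := {v}) (A := {s(v, a)}) (by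
          intro e he
          rw [Finset.mem_singleton.1 he, mem_iff_mem_of_sym2_eq (mk_ends _)]
          simp [hav])
        rwa [Finset.sum_singleton] at this
      linarith
  -- Uncrossing `X` with a tight set `Y` containing `a` and `b`: if `X ∩ Y` is odd, then `X ∪ Y` is
  -- tight and larger than `X`; otherwise both differences are odd, and the edge `va` forces one of
  -- their cuts below one.
  obtain ⟨Y, haY, hbY, hvY, hY, hY1⟩ := not_forall_lt_of_isMinOn hw hmin hQ (hd v a b) hwa hwb
  have c1 := Finset.card_inter_add_card_sdiff (X ∩ Q) Y
  have c2 := Finset.card_inter_add_card_sdiff (Y ∩ Q) X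
  have e1 : X ∩ Q ∩ Y = X ∩ Y ∩ Q := by ext; simp; tauto
  have e2 : Y ∩ Q ∩ X = X ∩ Y ∩ Q := by ext; simp; tauto
  have e3 : (X ∩ Q) \ Y = X \ Y ∩ Q := by ext; simp; tauto
  have e4 : (Y ∩ Q) \ X = Y \ X ∩ Q := by ext; simp; tauto
  rw [e1, e3] at c1
  rw [e2, e4] at c2
  obtain ⟨i, hi⟩ := hXodd
  obtain ⟨j, hj⟩ := hY
  by_cases hodd : Odd (X ∩ Y ∩ Q).card
  · have hun : Odd ((X ∪ Y) ∩ Q).card := by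
      have c3 := Finset.card_union_add_card_inter (X ∩ Q) (Y ∩ Q)
      have e5 : X ∩ Q ∪ Y ∩ Q = (X ∪ Y) ∩ Q := by ext; simp; tauto
      have e6 : X ∩ Q ∩ (Y ∩ Q) = X ∩ Y ∩ Q := by ext; simp
      rw [e5, e6] at c3
      obtain ⟨k, hk⟩ := hodd
      exact ⟨i + j - k, by omega⟩
    have h1 := cutSum_inter_add_cutSum_union_le (f := fstEnd) (g := sndEnd) hw0 X Y
    have h2 := hwodd _ hodd
    have h3 := hXmax (X ∪ Y) ⟨by simp [haX], by simp [hvX, hvY], hun, by linarith⟩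
    have h4 : X ⊂ X ∪ Y := Finset.ssubset_iff_subset_ne.2 ⟨Finset.subset_union_left, fun h =>
      hbX (h ▸ Finset.mem_union_right X hbY)⟩
    exact absurd (Finset.card_lt_card h4) (not_lt.2 h3)
  · obtain ⟨k, hk⟩ := Nat.not_odd_iff_even.1 hodd
    have h1 := cutSum_sdiff_add_cutSum_sdiff_le (f := fstEnd) (g := sndEnd) hw0 X Y
      (mk_ends s(v, a)) haX haY hvX hvY
    have h2 := hwodd (X \ Y) ⟨i - k, by omega⟩
    have h3 := hwodd (Y \ X) ⟨j - k, by omega⟩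
    simp only [pairCut] at *
    linarith

/-- Edge vectors that satisfy all `Q`-cut constraints cost at least as much as some perfect matching
of `Q`, for costs that satisfy the triangle inequality. -/
theorem exists_perfectMatching_le {Q : Finset V} {z d : Sym2 V → ℝ} (hz : ∀ e, 0 ≤ z e)
    (hodd : ∀ S : Finset V, Odd (S ∩ Q).card → 1 ≤ pairCut z S) (hd0 : ∀ e, 0 ≤ d e)
    (hd : ∀ v a b, d s(a, b) ≤ d s(v, a) + d s(v, b)) :
    ∃ p ∈ perfectMatchings fstEnd sndEnd Q, ∑ e, d e * p e ≤ ∑ e, d e * z e := by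
  have hQ : Even Q.card := by
    by_contra h
    have := hodd Finset.univ (by simpa using h)
    rw [pairCut, cutSum_univ] at this
    norm_num at this
  -- The cost is only kept below that of `z`, and the total weight is minimized: a splitting need
  -- not lower the cost strictly, but it always lowers the weight.
  obtain ⟨w, hw, hmin⟩ := (isCompact_joinRegion Q d (∑ e, z e) (∑ e, d e * z e)).exists_isMinOn
    ⟨z, hz, hodd, le_rfl, le_rfl⟩ (f := fun z : Sym2 V → ℝ => ∑ e, z e)
    (continuous_finsetSum _ fun e _ => continuous_apply e).continuousOn
  obtain ⟨hw0, hwodd, -, hwB⟩ := id hw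
  -- Weight on diagonal pairs, which degenerate splittings produce, can be discarded: it is in no
  -- cut and has nonnegative cost.
  let u : Sym2 V → ℝ := fun e => if fstEnd e = sndEnd e then 0 else w e
  have hcut : ∀ S, pairCut u S = pairCut w S := by
    intro S
    unfold pairCut cutSum
    refine Finset.sum_congr rfl fun e _ => ?_
    by_cases h : fstEnd e = sndEnd e <;> simp [u, h]
  have hu : u ∈ matchingPolytope fstEnd sndEnd Q := by
    refine ⟨⟨fun e => ?_, fun e he => ?_, fun v hv => ?_⟩, fun S hS => ?_⟩
    · simp only [u]
      split_ifs
      exacts [le_rfl, hw0 e]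
    · have hne : fstEnd e ≠ sndEnd e := fun h => he (by simp [u, h])
      have hwe : 0 < w e := lt_of_le_of_ne (hw0 e) fun h => he (by simp [u, ← h])
      refine ⟨hne, (degree_le_of_isMinOn hw hmin hQ hd hne.symm ?_).1,
        (degree_le_of_isMinOn hw hmin hQ hd hne ?_).1⟩
      · rwa [mk_ends]
      · rwa [Sym2.eq_swap, mk_ends]
    · have h1 : 1 ≤ pairCut w {v} := hwodd _ (by simp [hv])
      have h2 : ∃ e : Sym2 V, (if (fstEnd e ∈ ({v} : Finset V) ↔ sndEnd e ∈ ({v} : Finset V)) then 0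
          else w e) ≠ 0 := by
        by_contra! h
        unfold pairCut cutSum at h1
        rw [Finset.sum_eq_zero fun e _ => h e] at h1
        norm_num at h1
      obtain ⟨e, he⟩ := h2
      have hve : ¬ (fstEnd e ∈ ({v} : Finset V) ↔ sndEnd e ∈ ({v} : Finset V)) :=
        fun h => he (by rw [if_pos h])
      rw [if_neg hve] at he
      obtain ⟨a, hav, hea⟩ := exists_sym2_eq_of_mem_cut hve
      rw [mk_ends] at hea
      have h3 := (degree_le_of_isMinOn hw hmin hQ hd hav
        (hea ▸ lt_of_le_of_ne (hw0 e) (Ne.symm he))).2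
      change pairCut u {v} = 1
      rw [hcut]
      exact le_antisymm h3 h1
    · change 1 ≤ pairCut u S
      rw [hcut]
      exact hwodd S hS
  by_contra! hcon
  have hlin : IsLinearMap ℝ fun p : Sym2 V → ℝ => ∑ e, d e * p e :=
    ⟨fun p p' => by simp [mul_add, Finset.sum_add_distrib], fun c p => by
      simp only [Pi.smul_apply, smul_eq_mul, Finset.mul_sum]
      exact Finset.sum_congr rfl fun e _ => by ring⟩
  have h1 := convexHull_min (𝕜 := ℝ) (fun p hp => hcon p hp)
    (convex_halfSpace_gt hlin (∑ e, d e * z e)) (matchingPolytope_subset_convexHull _ _ _ hu)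
  have h2 : ∑ e, d e * u e ≤ ∑ e, d e * w e := Finset.sum_le_sum fun e _ => by
    refine mul_le_mul_of_nonneg_left ?_ (hd0 e)
    simp only [u]
    split_ifs
    exacts [hw0 e, le_rfl]
  have h3 : ∑ e, d e * z e < ∑ e, d e * u e := h1
  linarith

end SplittingOff

/-! ### Joins, parity of cuts, and the Edmonds–Johnson bound. -/

section Joins

open scoped symmDiff

theorem mk_mem_cut {U : Type*} {S : Set U} {a b : U} : s(a, b) ∈ cut S ↔ ¬ (a ∈ S ↔ b ∈ S) := by
  constructor
  · rintro ⟨c, hc, d, hd, h⟩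
    rcases Sym2.eq_iff.1 h with ⟨rfl, rfl⟩ | ⟨rfl, rfl⟩ <;> tauto
  · intro h
    by_cases ha : a ∈ S
    · exact ⟨a, ha, b, fun hb => h (by tauto), rfl⟩
    · exact ⟨b, by tauto, a, ha, Sym2.eq_swap⟩

variable {V : Type*}

theorem mem_odd {H : Multiset (Sym2 V)} {v : V} [DecidablePred fun e : Sym2 V => v ∈ e] :
    v ∈ odd H ↔ Odd (H.countP fun e => v ∈ e) := by
  simp only [odd, Set.mem_ofPred_eq]
  convert Iff.rfl

theorem odd_zero : odd (0 : Multiset (Sym2 V)) = ∅ := by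
  ext v
  simp [odd]

theorem odd_add (H K : Multiset (Sym2 V)) : odd (H + K) = odd H ∆ odd K := by
  ext v
  simp only [odd, Set.mem_ofPred_eq, Multiset.countP_add, Set.mem_symmDiff, Nat.odd_add,
    ← Nat.not_odd_iff_even]
  tauto

theorem odd_singleton {a b : V} (h : a ≠ b) : odd {s(a, b)} = ({a} : Set V) ∆ {b} := by
  classical
  ext v
  simp only [odd, Set.mem_ofPred_eq, Set.mem_symmDiff, Set.mem_singleton_iff]
  rw [← Multiset.cons_zero, Multiset.countP_cons]
  by_cases ha : v = a
  · subst ha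
    simp [h]
  · by_cases hb : v = b <;> simp [ha, hb]
    simp [Ne.symm h]

theorem odd_walk_edges {G : SimpleGraph V} {u v : V} (W : G.Walk u v) :
    odd (W.edges : Multiset (Sym2 V)) = ({u} : Set V) ∆ {v} := by
  induction W with
  | nil => simp [odd_zero]
  | @cons a b c h p ih =>
    rw [SimpleGraph.Walk.edges_cons, ← Multiset.cons_coe, ← Multiset.singleton_add, odd_add, ih,
      odd_singleton h.ne, symmDiff_assoc, symmDiff_symmDiff_cancel_left]

theorem multiLength_add (w : Sym2 V → ℝ) (H K : Multiset (Sym2 V)) :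
    multiLength w (H + K) = multiLength w H + multiLength w K := by
  simp [multiLength]

theorem multiLength_nonneg {G : SimpleGraph V} {w : Sym2 V → ℝ} (hw : ∀ e ∈ G.edgeSet, 0 ≤ w e)
    {J : Multiset (Sym2 V)} (hJ : ∀ e ∈ J, e ∈ G.edgeSet) : 0 ≤ multiLength w J :=
  Multiset.sum_nonneg fun x hx => by
    obtain ⟨e, he, rfl⟩ := Multiset.mem_map.1 hx
    exact hw e (hJ e he)

theorem IsJoin.add {G : SimpleGraph V} {Q R : Set V} {J K : Multiset (Sym2 V)}
    (hJ : IsJoin G Q J) (hK : IsJoin G R K) : IsJoin G (Q ∆ R) (J + K) := by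
  refine ⟨fun e he => ?_, by rw [odd_add, hJ.2, hK.2]⟩
  rcases Multiset.mem_add.1 he with h | h
  exacts [hJ.1 e h, hK.1 e h]

theorem isJoin_walk_edges {G : SimpleGraph V} {u v : V} (W : G.Walk u v) :
    IsJoin G (({u} : Set V) ∆ {v}) (W.edges : Multiset (Sym2 V)) :=
  ⟨fun _ he => W.edges_subset_edgeSet (Multiset.mem_coe.1 he), odd_walk_edges W⟩

/-- Removing pairs of parallel edges from a join. -/
theorem IsJoin.exists_nodup {G : SimpleGraph V} {w : Sym2 V → ℝ} (hw : ∀ e ∈ G.edgeSet, 0 ≤ w e)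
    {Q : Set V} {J : Multiset (Sym2 V)} (hJ : IsJoin G Q J) :
    ∃ J', IsJoin G Q J' ∧ J'.Nodup ∧ multiLength w J' ≤ multiLength w J := by
  induction h : J.card using Nat.strong_induction_on generalizing J with
  | _ n ih =>
  subst h
  by_cases hd : J.Nodup
  · exact ⟨J, hJ, hd, le_rfl⟩
  rw [Multiset.nodup_iff_le] at hd
  push Not at hd
  obtain ⟨e, he⟩ := hd
  obtain ⟨K, rfl⟩ := Multiset.le_iff_exists_add.1 he
  have h2 : (e ::ₘ e ::ₘ 0 : Multiset (Sym2 V)) = {e} + {e} := rfl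
  have hK : IsJoin G Q K := by
    refine ⟨fun e' he' => hJ.1 e' (Multiset.mem_add.2 (Or.inr he')), ?_⟩
    rw [← hJ.2, h2, odd_add, odd_add, symmDiff_self, bot_symmDiff]
  obtain ⟨J', h3, h4, h5⟩ := ih K.card (by simp) hK rfl
  refine ⟨J', h3, h4, h5.trans ?_⟩
  rw [multiLength_add]
  have : 0 ≤ multiLength w (e ::ₘ e ::ₘ 0) :=
    multiLength_nonneg hw fun e' he' => hJ.1 e' (Multiset.mem_add.2 (Or.inl he'))
  linarith

/-- There are infinitely many multisets, but cancelling pairs of parallel edges reduces the minimum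
to the finitely many joins without repetition. -/
theorem exists_isMinJoin [Finite V] {G : SimpleGraph V} {w : Sym2 V → ℝ}
    (hw : ∀ e ∈ G.edgeSet, 0 ≤ w e) {Q : Set V} (hQ : ∃ J, IsJoin G Q J) :
    ∃ J, IsMinJoin G w Q J := by
  have hfin : {J : Multiset (Sym2 V) | IsJoin G Q J ∧ J.Nodup}.Finite :=
    (Set.finite_range (Finset.val : Finset (Sym2 V) → Multiset (Sym2 V))).subset
      fun J hJ => ⟨⟨J, hJ.2⟩, rfl⟩
  obtain ⟨J₀, hJ₀⟩ := hQ
  obtain ⟨J₁, h1, h2, -⟩ := hJ₀.exists_nodup hw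
  obtain ⟨J, hJ, hmin⟩ := Set.exists_min_image _ (multiLength w) hfin ⟨J₁, h1, h2⟩
  refine ⟨J, hJ.1, fun J' hJ' => ?_⟩
  obtain ⟨J₂, h3, h4, h5⟩ := hJ'.exists_nodup hw
  exact (hmin J₂ ⟨h3, h4⟩).trans h5

/-- The set of ends of an unordered pair; it is empty for a diagonal pair. -/
def endSet (e : Sym2 V) : Set V :=
  Sym2.lift ⟨fun a b => ({a} : Set V) ∆ {b}, fun _ _ => symmDiff_comm _ _⟩ e

theorem mem_endSet [DecidableEq V] {e : Sym2 V} {v : V} :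
    v ∈ endSet e ↔ ¬ (fstEnd e ∈ ({v} : Finset V) ↔ sndEnd e ∈ ({v} : Finset V)) := by
  conv_lhs => rw [← mk_ends e]
  simp only [endSet, Sym2.lift_mk, Set.mem_symmDiff, Set.mem_singleton_iff, Finset.mem_singleton,
    eq_comm (a := v)]
  tauto

theorem exists_isMinJoin_endSet [Finite V] {G : SimpleGraph V} {w : Sym2 V → ℝ}
    (hG : G.Connected) (hw : ∀ e ∈ G.edgeSet, 0 ≤ w e) (e : Sym2 V) :
    ∃ J, IsMinJoin G w (endSet e) J := by
  induction e with
  | h a b =>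
    obtain ⟨W⟩ := hG.preconnected a b
    exact exists_isMinJoin hw ⟨_, isJoin_walk_edges W⟩

theorem countP_finsetSum {ι : Type*} (s : Finset ι) (m : ι → Multiset (Sym2 V))
    (p : Sym2 V → Prop) [DecidablePred p] :
    (∑ i ∈ s, m i).countP p = ∑ i ∈ s, (m i).countP p := by
  classical
  induction s using Finset.induction_on with
  | empty => simp
  | insert a s ha ih => rw [Finset.sum_insert ha, Finset.sum_insert ha, Multiset.countP_add, ih]

theorem multiLength_finsetSum {ι : Type*} (s : Finset ι) (m : ι → Multiset (Sym2 V))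
    (w : Sym2 V → ℝ) : multiLength w (∑ i ∈ s, m i) = ∑ i ∈ s, multiLength w (m i) := by
  classical
  induction s using Finset.induction_on with
  | empty => simp [multiLength]
  | insert a s ha ih => rw [Finset.sum_insert ha, Finset.sum_insert ha, multiLength_add, ih]

/-- Replacing the edges of a perfect matching of `Q` by joins of their ends gives a `Q`-join. -/
theorem isJoin_of_perfectMatching [Fintype V] [DecidableEq V] {G : SimpleGraph V}
    {m : Sym2 V → Multiset (Sym2 V)} (hm : ∀ e, IsJoin G (endSet e) (m e)) {Q : Finset V}
    {p : Sym2 V → ℝ} (hp : p ∈ perfectMatchings fstEnd sndEnd Q) [DecidablePred fun e => p e = 1] :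
    IsJoin G Q (∑ e with p e = 1, m e) := by
  classical
  refine ⟨fun e he => ?_, ?_⟩
  · obtain ⟨i, -, hi⟩ := Multiset.mem_sum.1 he
    exact (hm i).1 e hi
  ext v
  have h1 : v ∈ odd (∑ e with p e = 1, m e) ↔
      Odd (((Finset.univ.filter fun e => p e = 1).filter fun e => v ∈ endSet e).card) := by
    rw [mem_odd, countP_finsetSum, Finset.odd_sum_iff_odd_card_odd]
    have : ∀ e, v ∈ endSet e ↔ Odd ((m e).countP fun e => v ∈ e) := fun e => by
      rw [← (hm e).2, mem_odd]
    simp only [this]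
  rw [h1]
  have h2 : (((Finset.univ.filter fun e => p e = 1).filter fun e => v ∈ endSet e).card : ℝ) =
      pairCut p {v} := by
    rw [Finset.filter_filter, Finset.card_filter, Nat.cast_sum]
    refine Finset.sum_congr rfl fun e _ => ?_
    rw [mem_endSet]
    rcases hp.2 e with h | h <;>
      by_cases h' : (fstEnd e ∈ ({v} : Finset V) ↔ sndEnd e ∈ ({v} : Finset V)) <;> simp [h, h']
  by_cases hv : v ∈ Q
  · have h3 : pairCut p {v} = 1 := hp.1.degree v hv
    rw [h3, Nat.cast_eq_one] at h2
    rw [h2]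
    simp [hv]
  · have h3 : pairCut p {v} = 0 := by
      rw [pairCut, ← cutSum_inter_of_supp hp.1.supp, Finset.singleton_inter_of_notMem hv,
        cutSum_empty]
    rw [h3, Nat.cast_eq_zero] at h2
    rw [h2]
    simp [hv]

/-- An edge vector that satisfies all `Q`-cut constraints costs at least as much as some `Q`-join,
where the cost of a pair is the length of a shortest join of its ends. -/
theorem exists_isJoin_le [Fintype V] [DecidableEq V] {G : SimpleGraph V} {w : Sym2 V → ℝ}
    (hw : ∀ e ∈ G.edgeSet, 0 ≤ w e) {m : Sym2 V → Multiset (Sym2 V)}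
    (hm : ∀ e, IsMinJoin G w (endSet e) (m e)) {Q : Finset V} {z : Sym2 V → ℝ} (hz : ∀ e, 0 ≤ z e)
    (hodd : ∀ S : Finset V, Odd (S ∩ Q).card → 1 ≤ pairCut z S) :
    ∃ J, IsJoin G Q J ∧ multiLength w J ≤ ∑ e, multiLength w (m e) * z e := by
  classical
  -- The triangle inequality holds because joins of the ends of `va` and of `vb` add up to a join of
  -- the ends of `ab`.
  obtain ⟨p, hp, hle⟩ := exists_perfectMatching_le (d := fun e => multiLength w (m e)) hz hodd
    (fun e => multiLength_nonneg hw (hm e).1.1) fun v a b => by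
      rw [← multiLength_add]
      refine (hm s(a, b)).2 _ ?_
      have := (hm s(v, a)).1.add (hm s(v, b)).1
      have h2 : endSet s(v, a) ∆ endSet s(v, b) = endSet s(a, b) := by
        simp only [endSet, Sym2.lift_mk]
        rw [symmDiff_comm ({v} : Set V) {a}, symmDiff_assoc, symmDiff_symmDiff_cancel_left]
      rwa [h2] at this
  refine ⟨_, isJoin_of_perfectMatching (fun e => (hm e).1) hp, le_trans (le_of_eq ?_) hle⟩
  rw [multiLength_finsetSum, Finset.sum_filter]
  refine Finset.sum_congr rfl fun e _ => ?_
  rcases hp.2 e with h | h <;> simp [h]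

/-- In a loopless multigraph, a vertex set contains an odd number of odd-degree vertices if and only
if its cut has an odd number of edges. -/
theorem odd_card_filter_odd_iff {H : Multiset (Sym2 V)} (hH : ∀ e ∈ H, ¬ e.IsDiag)
    (S : Finset V) [DecidablePred fun v => v ∈ odd H]
    [DecidablePred fun e : Sym2 V => e ∈ cut (S : Set V)] :
    Odd (S.filter fun v => v ∈ odd H).card ↔ Odd (H.countP fun e => e ∈ cut (S : Set V)) := by
  classical
  have h1 : Odd (S.filter fun v => v ∈ odd H).card ↔ Odd (∑ v ∈ S, H.countP fun e => v ∈ e) := by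
    rw [Finset.odd_sum_iff_odd_card_odd]
    simp only [← mem_odd]
  rw [h1]
  clear h1
  rename_i inst _
  clear inst
  induction H using Multiset.induction_on with
  | empty => simp
  | cons e H ih =>
    have ih := ih fun e' he' => hH e' (Multiset.mem_cons_of_mem he')
    have he := hH e (Multiset.mem_cons_self e H)
    simp only [Multiset.countP_cons, Finset.sum_add_distrib]
    have h2 : Odd (∑ v ∈ S, if v ∈ e then 1 else 0) ↔
        Odd (if e ∈ cut (S : Set V) then 1 else 0) := by
      induction e with
      | h a b =>
        have hab : a ≠ b := by simpa using he
        have h3 : (∑ v ∈ S, if v ∈ s(a, b) then 1 else 0) =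
            (if a ∈ S then 1 else 0) + (if b ∈ S then 1 else 0) := by
          rw [← Finset.sum_ite_eq' S a fun _ => 1, ← Finset.sum_ite_eq' S b fun _ => 1,
            ← Finset.sum_add_distrib]
          refine Finset.sum_congr rfl fun v _ => ?_
          by_cases h1 : v = a
          · subst h1
            simp [hab]
          · by_cases h2 : v = b <;> simp [h1, h2]
            exact h2 ▸ h1
        rw [h3]
        simp only [mk_mem_cut, Finset.mem_coe]
        by_cases h1 : a ∈ S <;> by_cases h2 : b ∈ S <;> simp [h1, h2]
    simp only [Nat.odd_add, ← Nat.not_odd_iff_even, h2]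
    exact iff_congr ih Iff.rfl

end Joins

/-! ### Cut constraints under complete splittings. -/

section Splitting

set_option linter.unusedSectionVars false

variable {U : Type*} [Finite U]

theorem total_nonneg {f : Sym2 U → ℝ} {F : Set (Sym2 U)} (hf : ∀ e ∈ F, 0 ≤ f e) :
    0 ≤ total f F :=
  Finset.sum_nonneg fun e he => hf e (by simpa using he)

theorem cut_subset_edgeSet (S : Set U) : cut S ⊆ (⊤ : SimpleGraph U).edgeSet := by
  rintro e ⟨a, ha, b, hb, rfl⟩
  simp only [SimpleGraph.mem_edgeSet, SimpleGraph.top_adj]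
  rintro rfl
  exact hb ha

theorem minCut_le (x : Sym2 U → ℝ) {s t : U} {S : Set U} (hs : s ∈ S) (ht : t ∉ S) :
    minCut x s t ≤ total x (cut S) :=
  ciInf_le (Set.finite_range fun S : {S : Set U // s ∈ S ∧ t ∉ S} => total x (cut S.1)).bddBelow
    ⟨S, hs, ht⟩

theorem le_minCut {x : Sym2 U → ℝ} {s t : U} {c : ℝ} (hst : s ≠ t)
    (h : ∀ S : Set U, s ∈ S → t ∉ S → c ≤ total x (cut S)) : c ≤ minCut x s t := by
  have : Nonempty {S : Set U // s ∈ S ∧ t ∉ S} := ⟨⟨{s}, rfl, hst.symm⟩⟩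
  exact le_ciInf fun S => h S.1 S.2.1 S.2.2

theorem SplitOff.nonneg {v : U} {x x' : Sym2 U → ℝ} (h : SplitOff v x x')
    (hx : ∀ e ∈ (⊤ : SimpleGraph U).edgeSet, 0 ≤ x e) :
    ∀ e ∈ (⊤ : SimpleGraph U).edgeSet, 0 ≤ x' e := by
  classical
  intro e he
  have hxe := hx e he
  rcases h with ⟨a, b, ε, hav, hbv, hab, hε, ha, hb, rfl⟩ | ⟨a, ε, hav, hε, ha, rfl⟩
  · have h1 : s(v, a) ≠ s(v, b) := fun h => hab (Sym2.congr_right.1 h)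
    have h2 : 0 ≤ (Pi.single s(a, b) ε : Sym2 U → ℝ) e := by
      rw [Pi.single_apply]
      split_ifs
      exacts [hε.le, le_rfl]
    have h3 : 0 ≤ (x - Pi.single s(v, a) ε - Pi.single s(v, b) ε : Sym2 U → ℝ) e := by
      simp only [Pi.sub_apply]
      by_cases e1 : e = s(v, a)
      · subst e1
        rw [Pi.single_eq_same, Pi.single_eq_of_ne h1]
        linarith
      · by_cases e2 : e = s(v, b)
        · subst e2
          rw [Pi.single_eq_same, Pi.single_eq_of_ne h1.symm]
          linarith
        · rw [Pi.single_eq_of_ne e1, Pi.single_eq_of_ne e2]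
          linarith
    exact add_nonneg h3 h2
  · by_cases e1 : e = s(v, a)
    · subst e1
      simp only [Pi.sub_apply]
      rw [Pi.single_eq_same]
      linarith
    · simp only [Pi.sub_apply]
      rw [Pi.single_eq_of_ne e1]
      linarith

/-- The nonnegativity and cut constraints of the linear program; they are invariant under the
splitting loop. -/
def CutFeasible (r : U) (x : Sym2 U → ℝ) (y : U → ℝ) : Prop :=
  (∀ e ∈ (⊤ : SimpleGraph U).edgeSet, 0 ≤ x e) ∧
    ∀ S : Set U, r ∉ S → ∀ v ∈ S, 2 * y v ≤ total x (cut S)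

theorem LPFeasible.cutFeasible {r : U} {Ep : Set (Sym2 U)} {x : Sym2 U → ℝ} {y : U → ℝ}
    (h : LPFeasible r Ep x y) : CutFeasible r x y := by
  refine ⟨fun e he => ?_, h.cut_ge⟩
  by_cases hE : e ∈ Ep
  exacts [(h.pos_edge e hE).1, h.zero_edge e he hE]

theorem CompleteSplitting.nonneg {v : U} {x x' : Sym2 U → ℝ} (h : CompleteSplitting v x x')
    (hx : ∀ e ∈ (⊤ : SimpleGraph U).edgeSet, 0 ≤ x e) :
    ∀ e ∈ (⊤ : SimpleGraph U).edgeSet, 0 ≤ x' e := by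
  have := h.1
  clear h
  induction this with
  | refl => exact hx
  | tail _ h2 ih => exact h2.1.nonneg ih

theorem CompleteSplitting.minCut_le_minCut {v : U} {x x' : Sym2 U → ℝ}
    (h : CompleteSplitting v x x') {s t : U} (hs : s ≠ v) (ht : t ≠ v) (hst : s ≠ t) :
    minCut x s t ≤ minCut x' s t := by
  have := h.1
  clear h
  induction this with
  | refl => exact le_rfl
  | tail _ h2 ih => exact ih.trans (h2.2 s t hs ht hst)

/-- For fixed `u ≠ r`, the cut constraints say that the minimum `u`-`r` cut is at least `2 * y u`.
The root is never split, so for `u ≠ v` feasibility of the operations protects this cut; at `v`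
itself the new value of `y` is zero. -/
theorem SplittingPass.cutFeasible {r : U} {δ : ℝ} {z z' : (Sym2 U → ℝ) × (U → ℝ)}
    (h : SplittingPass r δ z z') (hz : CutFeasible r z.1 z.2) : CutFeasible r z'.1 z'.2 := by
  classical
  obtain ⟨v, hvr, -, -, hsp, hy⟩ := h
  have hnn := hsp.nonneg hz.1
  refine ⟨hnn, fun S hr u hu => ?_⟩
  rw [hy]
  by_cases huv : u = v
  · subst huv
    rw [Function.update_self, mul_zero]
    exact total_nonneg fun e he => hnn e (cut_subset_edgeSet S he)
  · have hur : u ≠ r := fun h => hr (h ▸ hu)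
    rw [Function.update_of_ne huv]
    exact (le_minCut hur fun S hs ht => hz.2 S ht u hs).trans
      ((hsp.minCut_le_minCut huv hvr.symm hur).trans (minCut_le _ hu hr))

theorem SplittingResult.cutFeasible {r : U} {δ : ℝ} {z z' : (Sym2 U → ℝ) × (U → ℝ)}
    (h : SplittingResult r δ z z') (hz : CutFeasible r z.1 z.2) : CutFeasible r z'.1 z'.2 := by
  have := h.1
  clear h
  induction this with
  | refl => exact hz
  | tail _ h2 ih => exact h2.cutFeasible ih

end Splitting

/-! ### Inequalities from the marginals of the random tree. -/

namespace IsTreeDecomposition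

variable {U : Type*} {r : U} {Ep : Set (Sym2 U)} {x : Sym2 U → ℝ} {y : U → ℝ}
  {𝒯 : Finset (⊤ : SimpleGraph U).Subgraph} {lam : (⊤ : SimpleGraph U).Subgraph → ℝ}

/-- A tree that contains an edge contains its ends. Together with the cut constraints this gives `2
* x e ≤ x(δ(S))` as soon as `S` contains an end of `e` but not the root. -/
theorem edge_le_vertex (h : IsTreeDecomposition r Ep x y 𝒯 lam) {e : Sym2 U} (he : e ∈ Ep) {v : U}
    (hv : v ∈ e) (hvr : v ≠ r) : x e ≤ y v := by
  classical
  rw [← h.edge_prob e he, ← h.vertex_prob v hvr]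
  refine Finset.sum_le_sum_of_subset_of_nonneg (fun T hT => ?_) fun T hT _ =>
    h.nonneg T (Finset.mem_filter.1 hT).1
  rw [Finset.mem_filter] at hT ⊢
  exact ⟨hT.1, T.mem_verts_of_mem_edge hT.2 hv⟩

theorem edge_le_one (h : IsTreeDecomposition r Ep x y 𝒯 lam) {e : Sym2 U} (he : e ∈ Ep) :
    x e ≤ 1 := by
  classical
  rw [← h.edge_prob e he, ← h.sum_eq_one]
  exact Finset.sum_le_sum_of_subset_of_nonneg (Finset.filter_subset _ _) fun T hT _ =>
    h.nonneg T hT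

theorem le_edge (h : IsTreeDecomposition r Ep x y 𝒯 lam) {e : Sym2 U} (he : e ∈ Ep)
    {T : (⊤ : SimpleGraph U).Subgraph} (hT : T ∈ 𝒯) (heT : e ∈ T.edgeSet) : lam T ≤ x e := by
  classical
  rw [← h.edge_prob e he]
  exact Finset.single_le_sum (f := lam) (fun T hT => h.nonneg T (Finset.mem_filter.1 hT).1)
    (Finset.mem_filter.2 ⟨hT, heT⟩)

/-- For a tree of positive probability this makes `y` positive at its non-root vertices, hence at
least `δ` once the splitting loop has stopped. -/
theorem le_vertex (h : IsTreeDecomposition r Ep x y 𝒯 lam) {v : U} (hvr : v ≠ r)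
    {T : (⊤ : SimpleGraph U).Subgraph} (hT : T ∈ 𝒯) (hvT : v ∈ T.verts) : lam T ≤ y v := by
  classical
  rw [← h.vertex_prob v hvr]
  exact Finset.single_le_sum (f := lam) (fun T hT => h.nonneg T (Finset.mem_filter.1 hT).1)
    (Finset.mem_filter.2 ⟨hT, hvT⟩)

end IsTreeDecomposition

/-! ### Cores, their layers, and cuts crossed once. -/

section Cores

set_option linter.unusedSectionVars false

variable {U : Type*}

theorem reachable_deleteVerts {C : (⊤ : SimpleGraph U).Subgraph} {S : Set U} {a b : C.verts}
    (W : C.coe.Walk a b) (hW : ∀ w ∈ W.support, (w : U) ∉ S)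
    (ha : (a : U) ∈ (C.deleteVerts S).verts) (hb : (b : U) ∈ (C.deleteVerts S).verts) :
    (C.deleteVerts S).coe.Reachable ⟨a, ha⟩ ⟨b, hb⟩ := by
  induction W with
  | nil => exact SimpleGraph.Reachable.refl _
  | @cons a c b h p ih =>
    have hc : (c : U) ∉ S := hW c (by simp)
    have hc' : (c : U) ∈ (C.deleteVerts S).verts := by
      simp [c.2, hc]
    refine SimpleGraph.Reachable.trans (SimpleGraph.Adj.reachable ?_)
      (ih (fun w hw => hW w (by simp [hw])) hc' hb)
    simp only [SimpleGraph.Subgraph.coe_adj, SimpleGraph.Subgraph.deleteVerts_adj]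
    exact ⟨a.2, hW a (by simp), c.2, hc, h⟩

/-- Deleting one side of a cut that a tree crosses only once leaves a tree. -/
theorem isTree_deleteVerts {C : (⊤ : SimpleGraph U).Subgraph} (hC : C.coe.IsTree) {r : U}
    (hr : r ∈ C.verts) {S : Set U} (hrS : r ∉ S) {e : Sym2 U}
    (hone : ∀ e' ∈ C.edgeSet, e' ∈ cut S → e' = e) : (C.deleteVerts S).coe.IsTree := by
  classical
  have hr' : r ∈ (C.deleteVerts S).verts := ⟨hr, hrS⟩
  refine ⟨?_, hC.2.comap _ (SimpleGraph.Subgraph.inclusion.injective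
    (SimpleGraph.Subgraph.deleteVerts_le (s := S)))⟩
  rw [SimpleGraph.connected_iff_exists_forall_reachable]
  refine ⟨⟨r, hr'⟩, fun u => ?_⟩
  obtain ⟨W, hW⟩ := (hC.1.preconnected ⟨r, hr⟩ ⟨u.1, u.2.1⟩).exists_isPath
  refine reachable_deleteVerts W (fun w hw hwS => ?_) hr' u.2
  -- A path between two vertices outside `S` that visits `S` has to enter and to leave it, and both
  -- times through `e`; but the edges of a path are distinct.
  let S' : Set C.verts := {v | (v : U) ∈ S}
  obtain ⟨d1, hd1, h1, h2⟩ := (W.takeUntil w hw).exists_boundary_dart S'ᶜ hrS (by simpa [S'])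
  obtain ⟨d2, hd2, h3, h4⟩ := (W.dropUntil w hw).exists_boundary_dart S' hwS u.2.2
  have key : ∀ d : C.coe.Dart, ¬ ((d.fst : U) ∈ S ↔ (d.snd : U) ∈ S) →
      d.edge.map Subtype.val = e := by
    intro d hd
    refine hone _ ?_ ?_
    · exact d.adj
    · exact mk_mem_cut.2 hd
  have e1 := key d1 (fun h => h2 (fun h' => h1 (h.2 h')))
  have e2 := key d2 (fun h => h4 (h.1 h3))
  have e12 : d1.edge = d2.edge := Sym2.map.injective Subtype.val_injective (e1.trans e2.symm)
  have hnd := hW.isTrail.edges_nodup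
  rw [← W.take_spec hw, SimpleGraph.Walk.edges_append, List.nodup_append] at hnd
  exact hnd.2.2 _ (List.mem_map_of_mem hd1) _ (List.mem_map_of_mem hd2) e12

variable [Finite U] {r : U} {Ep : Set (Sym2 U)} {x : Sym2 U → ℝ}
  {T : (⊤ : SimpleGraph U).Subgraph}

theorem core_anti (hT : T.coe.IsTree) (hr : r ∈ T.verts) {γ γ' : ℝ} (h : γ ≤ γ') :
    core r Ep x T γ' ≤ core r Ep x T γ := by
  have h1 := (core_isLeast (Ep := Ep) (x := x) (γ := γ) hT hr).1
  exact sInf_le ⟨h1.1, h1.2.1, h1.2.2.1, fun e he hx => h1.2.2.2 e he (h.trans hx)⟩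

theorem singletonSubgraph_mem_coreCandidates (hT : T.coe.IsTree) (hr : r ∈ T.verts) {γ : ℝ}
    (h : ∀ e ∈ T.edgeSet ∩ Ep, ¬ γ ≤ x e) :
    (⊤ : SimpleGraph U).singletonSubgraph r ∈ coreCandidates r Ep x T γ := by
  have hle : (⊤ : SimpleGraph U).singletonSubgraph r ≤ T :=
    (SimpleGraph.singletonSubgraph_le_iff r T).2 hr
  refine ⟨hle, ⟨?_, hT.2.comap _ (SimpleGraph.Subgraph.inclusion.injective hle)⟩, rfl,
    fun e he hx => absurd hx (h e he)⟩
  exact (SimpleGraph.Subgraph.connected_iff'.1 SimpleGraph.Subgraph.singletonSubgraph_connected)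

/-- Every edge of a core lies in one of the layers between consecutive cores. -/
theorem exists_layer (hT : T.coe.IsTree) (hr : r ∈ T.verts) {q : ℕ} {η : ℕ → ℝ}
    (hη : EnumeratesPositiveValues Ep x q η) (hpos : ∀ e ∈ T.edgeSet ∩ Ep, 0 < x e) {γ : ℝ}
    {e : Sym2 U} (he : e ∈ (core r Ep x T γ).edgeSet) :
    ∃ i ∈ Finset.Icc 1 q, γ ≤ η i ∧ e ∈ (coreSeq r Ep x T η i).edgeSet \
      (coreSeq r Ep x T η (i - 1)).edgeSet := by
  classical
  have hsing : ∀ γ', e ∈ (core r Ep x T γ').edgeSet → ∃ f ∈ T.edgeSet ∩ Ep, γ' ≤ x f := by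
    intro γ' he'
    by_contra! h
    have h1 : core r Ep x T γ' ≤ _ := sInf_le (singletonSubgraph_mem_coreCandidates (γ := γ') hT hr
      fun e he => not_le.2 (h e he))
    have := SimpleGraph.Subgraph.edgeSet_mono h1 he'
    simp at this
  have hval : ∀ f ∈ T.edgeSet ∩ Ep, ∃ j ∈ Finset.Icc 1 q, η j = x f := by
    intro f hf
    have : x f ∈ η '' Set.Icc 1 q := by
      rw [hη.2]
      exact ⟨hpos f hf, f, hf.2, rfl⟩
    obtain ⟨j, hj, hjx⟩ := this
    exact ⟨j, by simpa using hj, hjx⟩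
  -- The largest index `k` in `N` belongs to the smallest value that is at least `γ`. No edge value
  -- of the tree lies in between, so the cores for `γ` and `η k` have the same defining edges. The
  -- layer of `e` is then the least index in `N` whose core contains `e`.
  set N := (Finset.Icc 1 q).filter fun i => γ ≤ η i with hN
  have hNne : N.Nonempty := by
    obtain ⟨f, hf, hγ⟩ := hsing γ he
    obtain ⟨j, hj, hjx⟩ := hval f hf
    exact ⟨j, Finset.mem_filter.2 ⟨hj, hjx ▸ hγ⟩⟩
  obtain ⟨k, hk, hkmax⟩ := N.exists_max_image id hNne
  have hkq := (Finset.mem_filter.1 hk).1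
  have hek : e ∈ (core r Ep x T (η k)).edgeSet := by
    have h1 := (core_isLeast (Ep := Ep) (x := x) (γ := η k) hT hr).1
    have h2 : core r Ep x T γ ≤ core r Ep x T (η k) := by
      refine sInf_le ⟨h1.1, h1.2.1, h1.2.2.1, fun f hf hx => h1.2.2.2 f hf ?_⟩
      obtain ⟨j, hj, hjx⟩ := hval f hf
      rw [← hjx] at hx ⊢
      exact hη.1.antitoneOn (by simpa using hj) (by simpa using hkq)
        (hkmax j (Finset.mem_filter.2 ⟨hj, hx⟩))
    exact SimpleGraph.Subgraph.edgeSet_mono h2 he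
  obtain ⟨i, hi, himin⟩ := (N.filter fun i => e ∈ (core r Ep x T (η i)).edgeSet).exists_min_image id
    ⟨k, Finset.mem_filter.2 ⟨hk, hek⟩⟩
  obtain ⟨hiN, hei⟩ := Finset.mem_filter.1 hi
  obtain ⟨hiq, hγi⟩ := Finset.mem_filter.1 hiN
  have hi1 := Finset.mem_Icc.1 hiq
  refine ⟨i, hiq, hγi, ?_, fun h => ?_⟩
  · rwa [coreSeq, if_neg (by omega)]
  -- The tree with index zero has no edges; for `i > 1` the larger value `η (i - 1)` keeps `i - 1`
  -- in `N`, against the choice of `i`.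
  · rw [coreSeq] at h
    split_ifs at h with h0
    · simp at h
    · have hi' : i - 1 ∈ Finset.Icc 1 q := Finset.mem_Icc.2 ⟨by omega, by omega⟩
      have hlt : η i < η (i - 1) :=
        hη.1 (by simpa using hi') (by simpa using hiq) (by omega)
      have := himin (i - 1) (Finset.mem_filter.2 ⟨Finset.mem_filter.2 ⟨hi', hγi.trans hlt.le⟩, h⟩)
      simp only [id] at this
      omega

/-- If a core crosses a cut in a single edge, then it has a defining edge with an end on the far
side of the cut. -/
theorem exists_mem_of_core_cut (hT : T.coe.IsTree) (hr : r ∈ T.verts) {γ : ℝ} {S : Set U}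
    (hrS : r ∉ S) {e : Sym2 U} (he : e ∈ (core r Ep x T γ).edgeSet) (heS : e ∈ cut S)
    (hone : ∀ e' ∈ (core r Ep x T γ).edgeSet, e' ∈ cut S → e' = e) :
    ∃ f ∈ Ep, γ ≤ x f ∧ ∃ v ∈ S, v ∈ f := by
  -- Otherwise nothing in `S` is needed: deleting `S` leaves a smaller candidate tree, against the
  -- minimality of the core.
  by_contra! hcon
  have h1 := (core_isLeast (Ep := Ep) (x := x) (γ := γ) hT hr).1
  have h2 : core r Ep x T γ ≤ (core r Ep x T γ).deleteVerts S := by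
    refine sInf_le ⟨SimpleGraph.Subgraph.deleteVerts_le.trans h1.1,
      isTree_deleteVerts h1.2.1 h1.2.2.1 hrS hone, ⟨h1.2.2.1, hrS⟩, fun f hf hx => ?_⟩
    have h3 := h1.2.2.2 f hf hx
    have h4 := hcon f hf.2 hx
    induction f with
    | h a b =>
      have ha : a ∉ S := fun h => h4 a h (Sym2.mem_mk_left a b)
      have hb : b ∉ S := fun h => h4 b h (Sym2.mem_mk_right a b)
      have hab : (core r Ep x T γ).Adj a b := h3
      simp only [SimpleGraph.Subgraph.mem_edgeSet, SimpleGraph.Subgraph.deleteVerts_adj]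
      exact ⟨hab.fst_mem, ha, hab.snd_mem, hb, hab⟩
  obtain ⟨a, ha, b, hb, rfl⟩ := heS
  have h3 : a ∈ (core r Ep x T γ).verts := (show (core r Ep x T γ).Adj a b from he).fst_mem
  exact (SimpleGraph.Subgraph.verts_mono h2 h3).2 ha

end Cores

/-! ### The parity correction vector and its feasibility. -/

section Correction

variable {U : Type*}

open Classical in
/-- The weight that the layers between consecutive cores contribute to the parity correction
vector at `e`. -/
noncomputable def layerWeight (r : U) (Ep : Set (Sym2 U)) (x : Sym2 U → ℝ)
    (T : (⊤ : SimpleGraph U).Subgraph) (δ γ : ℝ) (q : ℕ) (η : ℕ → ℝ) (e : Sym2 U) : ℝ :=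
  ∑ i ∈ Finset.Icc 1 q with γ ≤ η i, (1 - 2 * η i / (3 - δ)) *
    if e ∈ (coreSeq r Ep x T η i).edgeSet \ (coreSeq r Ep x T η (i - 1)).edgeSet then 1 else 0

/-- The parity correction vector. -/
noncomputable def correction (r : U) (Ep : Set (Sym2 U)) (x : Sym2 U → ℝ)
    (T : (⊤ : SimpleGraph U).Subgraph) (δ γ : ℝ) (q : ℕ) (η : ℕ → ℝ) (e : Sym2 U) : ℝ :=
  1 / (3 - δ) * x e + layerWeight r Ep x T δ γ q η e

variable {r : U} {Ep : Set (Sym2 U)} {x : Sym2 U → ℝ} {y : U → ℝ}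
  {T : (⊤ : SimpleGraph U).Subgraph} {δ γ : ℝ} {q : ℕ} {η : ℕ → ℝ}

theorem total_mul_correction [Finite U] (w : Sym2 U → ℝ) :
    total (fun e => w e * correction r Ep x T δ γ q η e) (⊤ : SimpleGraph U).edgeSet =
      1 / (3 - δ) * total (fun e => w e * x e) (⊤ : SimpleGraph U).edgeSet +
        ∑ i ∈ Finset.Icc 1 q with γ ≤ η i, (1 - 2 * η i / (3 - δ)) *
          total w ((coreSeq r Ep x T η i).edgeSet \ (coreSeq r Ep x T η (i - 1)).edgeSet) := by
  classical
  have hw : ∀ L : Set (Sym2 U), L ⊆ (⊤ : SimpleGraph U).edgeSet →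
      total w L = ∑ e ∈ (⊤ : SimpleGraph U).edgeSet.toFinite.toFinset,
        w e * if e ∈ L then 1 else 0 := by
    intro L hL
    simp only [mul_ite, mul_one, mul_zero]
    rw [← Finset.sum_filter]
    refine Finset.sum_congr ?_ fun _ _ => rfl
    ext e
    simp only [Set.Finite.mem_toFinset, Finset.mem_filter]
    exact ⟨fun h => ⟨hL h, h⟩, fun h => h.2⟩
  have hsub : ∀ i, (coreSeq r Ep x T η i).edgeSet \ (coreSeq r Ep x T η (i - 1)).edgeSet ⊆
      (⊤ : SimpleGraph U).edgeSet := fun i =>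
    Set.sdiff_subset.trans (SimpleGraph.Subgraph.edgeSet_subset _)
  simp only [hw _ (hsub _)]
  simp only [total, correction, layerWeight, mul_add, Finset.sum_add_distrib, Finset.mul_sum]
  congr 1
  · exact Finset.sum_congr rfl fun e _ => mul_left_comm _ _ _
  · rw [Finset.sum_comm]
    exact Finset.sum_congr rfl fun i _ => Finset.sum_congr rfl fun e _ => by
      split_ifs <;> ring

/-- As `3 - δ ≥ 2`, all layer coefficients are nonnegative. The lower bound equals `(1 - δ) / (3 -
δ)` and does not depend on the layer, so it serves for cuts with several core edges. -/
theorem layerCoeff_nonneg (hδ : δ ∈ Set.Icc (0 : ℝ) 1) {t : ℝ} (ht : t ≤ 1) :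
    1 - 2 / (3 - δ) ≤ 1 - 2 * t / (3 - δ) ∧ 0 ≤ 1 - 2 * t / (3 - δ) := by
  have h3 : 0 < 3 - δ := by linarith [hδ.2]
  constructor
  · have : 2 * t / (3 - δ) ≤ 2 / (3 - δ) := div_le_div_of_nonneg_right (by linarith) h3.le
    linarith
  · have : 2 * t / (3 - δ) ≤ 1 := (div_le_one h3).2 (by linarith [hδ.2])
    linarith

theorem EnumeratesPositiveValues.le_one (hη : EnumeratesPositiveValues Ep x q η)
    (hx : ∀ e ∈ Ep, x e ≤ 1) {i : ℕ} (hi : i ∈ Finset.Icc 1 q) : η i ≤ 1 := by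
  have : η i ∈ {t | 0 < t ∧ ∃ e ∈ Ep, x e = t} := by
    rw [← hη.2]
    exact ⟨i, by simpa using hi, rfl⟩
  obtain ⟨-, e, he, h⟩ := this
  exact h ▸ hx e he

theorem layerWeight_ge (hη : EnumeratesPositiveValues Ep x q η) (hx : ∀ e ∈ Ep, x e ≤ 1)
    (hδ : δ ∈ Set.Icc (0 : ℝ) 1) {e : Sym2 U} {i : ℕ} (hi : i ∈ Finset.Icc 1 q) (hγ : γ ≤ η i)
    (he : e ∈ (coreSeq r Ep x T η i).edgeSet \ (coreSeq r Ep x T η (i - 1)).edgeSet) :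
    1 - 2 * η i / (3 - δ) ≤ layerWeight r Ep x T δ γ q η e := by
  classical
  unfold layerWeight
  refine le_trans (le_of_eq ?_) (Finset.single_le_sum (fun j hj => ?_)
    (Finset.mem_filter.2 ⟨hi, hγ⟩))
  · rw [if_pos he, mul_one]
  · refine mul_nonneg (layerCoeff_nonneg hδ (hη.le_one hx (Finset.mem_filter.1 hj).1)).2 ?_
    split_ifs <;> norm_num

theorem layerWeight_nonneg (hη : EnumeratesPositiveValues Ep x q η) (hx : ∀ e ∈ Ep, x e ≤ 1)
    (hδ : δ ∈ Set.Icc (0 : ℝ) 1) (e : Sym2 U) : 0 ≤ layerWeight r Ep x T δ γ q η e :=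
  Finset.sum_nonneg fun j hj => by
    refine mul_nonneg (layerCoeff_nonneg hδ (hη.le_one hx (Finset.mem_filter.1 hj).1)).2 ?_
    split_ifs <;> norm_num

variable [Finite U] {𝒯 : Finset (⊤ : SimpleGraph U).Subgraph}
  {lam : (⊤ : SimpleGraph U).Subgraph → ℝ}

/-- The parity correction vector satisfies the cut constraints of the odd cuts of a core. -/
theorem one_le_total_correction_of_notMem (hxy : CutFeasible r x y) (hδ : δ ∈ Set.Icc (0 : ℝ) 1)
    (hy : ∀ v, v ≠ r → ¬ (0 < y v ∧ y v < δ)) (hdec : IsTreeDecomposition r Ep x y 𝒯 lam)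
    (hT : T ∈ 𝒯) (hlam : 0 < lam T) (hη : EnumeratesPositiveValues Ep x q η) {S : Set U}
    (hrS : r ∉ S) {F : Finset (Sym2 U)}
    (hF : ∀ e, e ∈ F ↔ e ∈ (core r Ep x T γ).edgeSet ∧ e ∈ cut S) (hodd : Odd F.card) :
    1 ≤ total (correction r Ep x T δ γ q η) (cut S) := by
  classical
  have h3 : 0 < 3 - δ := by linarith [hδ.2]
  have hTt := hdec.isTree T hT
  have hr := hdec.root_mem T hT
  have hpos : ∀ e ∈ T.edgeSet ∩ Ep, 0 < x e := fun e he =>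
    hlam.trans_le (hdec.le_edge he.2 hT he.1)
  have hx1 : ∀ e ∈ Ep, x e ≤ 1 := fun e he => hdec.edge_le_one he
  have hsum : total (correction r Ep x T δ γ q η) (cut S) =
      1 / (3 - δ) * total x (cut S) + total (layerWeight r Ep x T δ γ q η) (cut S) := by
    simp only [total, correction, Finset.sum_add_distrib, Finset.mul_sum]
  have hFsum : ∑ e ∈ F, layerWeight r Ep x T δ γ q η e ≤
      total (layerWeight r Ep x T δ γ q η) (cut S) :=
    Finset.sum_le_sum_of_subset_of_nonneg (fun e he => by simpa using ((hF e).1 he).2)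
      fun e _ _ => layerWeight_nonneg hη hx1 hδ e
  rw [hsum]
  -- One core edge `e`, in layer `i`: the smaller core `T_i` also crosses the cut only in `e`, so
  -- one of its defining edges has an end in `S`. This gives `2 * η i ≤ x(δ(S))`, exactly what the
  -- coefficient of the layer lacks to one.
  by_cases h1 : F.card = 1
  · obtain ⟨e, rfl⟩ := Finset.card_eq_one.1 h1
    obtain ⟨he, heS⟩ := (hF e).1 (Finset.mem_singleton_self e)
    obtain ⟨i, hi, hγ, hei⟩ := exists_layer hTt hr hη hpos he
    have hei' : e ∈ (core r Ep x T (η i)).edgeSet := by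
      have := hei.1
      rwa [coreSeq, if_neg (by have := Finset.mem_Icc.1 hi; omega)] at this
    obtain ⟨f, hf, hfx, v, hvS, hvf⟩ := exists_mem_of_core_cut hTt hr hrS hei' heS
      fun e' he' he'S => Finset.mem_singleton.1
        ((hF e').2 ⟨SimpleGraph.Subgraph.edgeSet_mono (core_anti hTt hr hγ) he', he'S⟩)
    have hvr : v ≠ r := fun h => hrS (h ▸ hvS)
    have h4 : 2 * η i ≤ total x (cut S) := by
      have := hxy.2 S hrS v hvS
      have := hdec.edge_le_vertex hf hvf hvr
      linarith
    have h5 := layerWeight_ge hη hx1 hδ hi hγ hei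
    rw [Finset.sum_singleton] at hFsum
    have h6 : 2 * η i / (3 - δ) ≤ 1 / (3 - δ) * total x (cut S) := by
      rw [one_div, inv_mul_eq_div]
      exact div_le_div_of_nonneg_right h4 h3.le
    linarith
  -- At least three core edges: their layers are unknown, but a tree vertex in `S` gives `x(δ(S)) ≥
  -- 2δ`. The identity `2δ + 3(1 - δ) = 3 - δ` is the reason for the denominator.
  · have hcard : 3 ≤ F.card := by
      obtain ⟨k, hk⟩ := hodd
      omega
    obtain ⟨e, heF⟩ := Finset.card_pos.1 (show 0 < F.card by omega)
    obtain ⟨he, heS⟩ := (hF e).1 heF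
    obtain ⟨v, hvS, hve⟩ : ∃ v ∈ S, v ∈ e := by
      obtain ⟨a, ha, b, -, rfl⟩ := heS
      exact ⟨a, ha, Sym2.mem_mk_left a b⟩
    have hvr : v ≠ r := fun h => hrS (h ▸ hvS)
    have hvT : v ∈ T.verts := T.mem_verts_of_mem_edge
      (SimpleGraph.Subgraph.edgeSet_mono (core_isLeast hTt hr).1.1 he) hve
    have hyv : δ ≤ y v := by
      have h4 := hdec.le_vertex hvr hT hvT
      by_contra! h
      exact hy v hvr ⟨hlam.trans_le h4, h⟩
    have h5 : 2 * δ ≤ total x (cut S) := by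
      have := hxy.2 S hrS v hvS
      linarith
    have h6 : ∀ e ∈ F, 1 - 2 / (3 - δ) ≤ layerWeight r Ep x T δ γ q η e := by
      intro e he
      obtain ⟨i, hi, hγ, hei⟩ := exists_layer hTt hr hη hpos ((hF e).1 he).1
      exact (layerCoeff_nonneg hδ (hη.le_one hx1 hi)).1.trans (layerWeight_ge hη hx1 hδ hi hγ hei)
    have h7 := Finset.card_nsmul_le_sum F _ _ h6
    rw [nsmul_eq_mul] at h7
    have h8 : 0 ≤ 1 - 2 / (3 - δ) := by
      have := (div_le_one h3).2 (show (2 : ℝ) ≤ 3 - δ by linarith [hδ.2])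
      linarith
    have h9 : (3 : ℝ) ≤ F.card := by exact_mod_cast hcard
    have h10 : 3 * (1 - 2 / (3 - δ)) ≤ F.card * (1 - 2 / (3 - δ)) :=
      mul_le_mul_of_nonneg_right h9 h8
    have h11 : 1 / (3 - δ) * (2 * δ) ≤ 1 / (3 - δ) * total x (cut S) :=
      mul_le_mul_of_nonneg_left h5 (by positivity)
    have h12 : 1 / (3 - δ) * (2 * δ) + 3 * (1 - 2 / (3 - δ)) = 1 := by
      field_simp
      ring
    linarith

theorem one_le_total_correction (hxy : CutFeasible r x y) (hδ : δ ∈ Set.Icc (0 : ℝ) 1)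
    (hy : ∀ v, v ≠ r → ¬ (0 < y v ∧ y v < δ)) (hdec : IsTreeDecomposition r Ep x y 𝒯 lam)
    (hT : T ∈ 𝒯) (hlam : 0 < lam T) (hη : EnumeratesPositiveValues Ep x q η) {S : Set U}
    {F : Finset (Sym2 U)}
    (hF : ∀ e, e ∈ F ↔ e ∈ (core r Ep x T γ).edgeSet ∧ e ∈ cut S) (hodd : Odd F.card) :
    1 ≤ total (correction r Ep x T δ γ q η) (cut S) := by
  by_cases hrS : r ∈ S
  · have hc : cut Sᶜ = cut S := by
      ext e
      induction e with
      | h a b => simp only [mk_mem_cut, Set.mem_compl_iff, not_iff_not]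
    rw [← hc]
    exact one_le_total_correction_of_notMem hxy hδ hy hdec hT hlam hη (by simpa using hrS)
      (by rwa [hc]) hodd
  · exact one_le_total_correction_of_notMem hxy hδ hy hdec hT hlam hη hrS hF hodd

end Correction

/-! ### Restoration: merging copies, lengths and parities. -/

namespace Instance

open scoped symmDiff

variable {V : Type*} (I : Instance V)

theorem map_merge_mem_edgeSet {f : Sym2 I.HatV} (hf : f ∈ I.copyGraph.edgeSet)
    (hd : ¬ (f.map I.merge).IsDiag) : f.map I.merge ∈ I.graph.edgeSet := by
  rw [copyGraph, SimpleGraph.edgeSet_fromEdgeSet] at hf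
  rcases hf.1 with (⟨u, v, huv, -, rfl⟩ | ⟨c, rfl⟩) | ⟨d, -, rfl⟩
  · exact huv
  · exact absurd rfl hd
  · rw [Sym2.map_mk, merge_attach, merge_attach]
    exact d.adj

open Classical in
/-- Merging the copies turns a walk in the graph after the vertex-copying step into a join of the
merged ends, of the same length. -/
theorem isJoin_merge_walk {a b : I.HatV} (W : I.copyGraph.Walk a b) :
    IsJoin I.graph (({I.merge a} : Set V) ∆ {I.merge b})
      (((W.edges : Multiset (Sym2 I.HatV)).map (Sym2.map I.merge)).filter fun e => ¬ e.IsDiag) ∧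
    multiLength I.length
      (((W.edges : Multiset (Sym2 I.HatV)).map (Sym2.map I.merge)).filter fun e => ¬ e.IsDiag) =
      I.walkLength W := by
  induction W with
  | nil =>
    refine ⟨⟨by simp, by simp [odd_zero]⟩, by simp [multiLength, walkLength]⟩
  | @cons a c b h p ih =>
    rw [SimpleGraph.Walk.edges_cons, ← Multiset.cons_coe, Multiset.map_cons]
    have hlen : I.walkLength (SimpleGraph.Walk.cons h p) =
        I.copyLength s(a, c) + I.walkLength p := by
      simp [walkLength]
    rw [hlen]
    -- An edge that merges to a loop is filtered out, has length zero and does not move the merged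
    -- end, so it affects neither claim.
    by_cases hd : (Sym2.map I.merge s(a, c)).IsDiag
    · have hac : I.merge a = I.merge c := by simpa using hd
      rw [Multiset.filter_cons_of_neg _ (by simpa using hd), hac, copyLength, if_pos hd, zero_add]
      exact ih
    · have hac : I.merge a ≠ I.merge c := by simpa using hd
      rw [Multiset.filter_cons_of_pos (p := fun e : Sym2 V => ¬ e.IsDiag) _ hd,
        ← Multiset.singleton_add, multiLength_add, ih.2,
        copyLength, if_neg hd]
      refine ⟨?_, by simp [multiLength]⟩
      have h1 : IsJoin I.graph (({I.merge a} : Set V) ∆ {I.merge c})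
          {Sym2.map I.merge s(a, c)} := by
        refine ⟨fun e he => ?_, odd_singleton hac⟩
        rw [Multiset.mem_singleton.1 he]
        exact I.map_merge_mem_edgeSet h hd
      have := h1.add ih.1
      rwa [symmDiff_assoc, symmDiff_symmDiff_cancel_left] at this

/-- The restoration of an edge is a join of the merged ends, of the same length. -/
theorem isJoin_restoreEdge {P : Sym2 I.HatV → Multiset (Sym2 I.HatV)}
    (hP : I.IsShortestPathSystem P) {f : Sym2 I.HatV} (hf : f ∈ (⊤ : SimpleGraph I.HatV).edgeSet) :
    IsJoin I.graph (endSet (f.map I.merge)) (I.restoreEdge P f) ∧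
      multiLength I.length (I.restoreEdge P f) = I.hatLength f := by
  classical
  unfold restoreEdge
  by_cases hfp : f ∈ I.hatPos
  · rw [if_pos hfp, hatLength, if_pos hfp]
    obtain ⟨d, -, rfl⟩ := hfp
    have h1 : Sym2.map I.merge s(I.attach d, I.attach d.symm) = s(d.fst, d.snd) := by
      rw [Sym2.map_mk, merge_attach, merge_attach]
      rfl
    have h2 : ¬ (s(d.fst, d.snd)).IsDiag := by simp
    rw [Multiset.map_singleton, copyLength, h1, if_neg h2, Multiset.filter_singleton, if_pos h2]
    refine ⟨⟨fun e he => ?_, odd_singleton d.adj.ne⟩, by simp [multiLength]⟩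
    rw [Multiset.mem_singleton.1 he]
    exact d.adj
  · rw [if_neg hfp]
    induction f with
    | h a b =>
      obtain ⟨W, -, hW, hPW⟩ := hP a b (by simpa using hf) hfp
      rw [hPW, ← hW]
      exact I.isJoin_merge_walk W

/-- The parity of a cut depends only on the odd vertices, and a join of the ends of `e` has the same
ones as the single edge `e`, or none if `e` is a loop. -/
theorem odd_countP_cut_iff_of_isJoin [DecidableEq V] {G : SimpleGraph V} {e : Sym2 V}
    {J : Multiset (Sym2 V)} (hJ : IsJoin G (endSet e) J) (S : Finset V)
    [DecidablePred fun e : Sym2 V => e ∈ cut (S : Set V)] :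
    Odd (J.countP fun e => e ∈ cut (S : Set V)) ↔ e ∈ cut (S : Set V) := by
  classical
  rw [← odd_card_filter_odd_iff (fun e he => G.not_isDiag_of_mem_edgeSet (hJ.1 e he))]
  induction e with
  | h a b =>
    have h1 : odd J = ({a} : Set V) ∆ {b} := hJ.2
    by_cases hab : a = b
    · have h2 : odd J = ∅ := by rw [h1, hab, symmDiff_self]; rfl
      simp only [h2, mk_mem_cut, hab]
      simp
    · have h2 : odd J = odd {s(a, b)} := by rw [h1, odd_singleton hab]
      simp only [h2]
      rw [odd_card_filter_odd_iff (fun e he => by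
        rw [Multiset.mem_singleton.1 he]; simpa using hab), ← Multiset.cons_zero,
        Multiset.countP_cons]
      by_cases hc : s(a, b) ∈ cut (S : Set V) <;> simp [hc]

theorem map_merge_mem_cut_iff {f : Sym2 I.HatV} {S : Set V} :
    f.map I.merge ∈ cut S ↔ f ∈ cut (I.merge ⁻¹' S) := by
  induction f with
  | h a b => simp only [Sym2.map_mk, mk_mem_cut, Set.mem_preimage]

/-- A vertex set contains an odd number of odd-degree vertices of a restored subgraph if and only if
the subgraph has an odd number of edges in the corresponding cut. -/
theorem odd_card_inter_odd_restore_iff [Finite V] [DecidableEq V]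
    {P : Sym2 I.HatV → Multiset (Sym2 I.HatV)} (hP : I.IsShortestPathSystem P)
    (C : (⊤ : SimpleGraph I.HatV).Subgraph) (S : Finset V)
    [DecidablePred fun v => v ∈ odd (I.restore P C)]
    [DecidablePred fun f : Sym2 I.HatV => f ∈ cut (I.merge ⁻¹' (S : Set V))] :
    Odd (S.filter fun v => v ∈ odd (I.restore P C)).card ↔
      Odd (C.edgeSet.toFinite.toFinset.filter fun f => f ∈ cut (I.merge ⁻¹' (S : Set V))).card := by
  classical
  have hC : ∀ f ∈ C.edgeSet.toFinite.toFinset, f ∈ (⊤ : SimpleGraph I.HatV).edgeSet := fun f hf =>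
    C.edgeSet_subset (by simpa using hf)
  rw [odd_card_filter_odd_iff, restore, countP_finsetSum, Finset.odd_sum_iff_odd_card_odd]
  · rw [Finset.filter_congr fun f hf => by
      rw [odd_countP_cut_iff_of_isJoin (I.isJoin_restoreEdge hP (hC f hf)).1,
        map_merge_mem_cut_iff]]
  · intro e he
    obtain ⟨f, hf, hef⟩ := Multiset.mem_sum.1 he
    exact I.graph.not_isDiag_of_mem_edgeSet ((I.isJoin_restoreEdge hP (hC f hf)).1.1 e hef)

end Instance

/-- A weighted sum over all pairs of the push-forward of an edge vector. -/
theorem sum_mul_fiberwise {A B : Type*} [Fintype B] [DecidableEq B] (s : Finset A) (φ : A → B)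
    (c : A → ℝ) (h : B → ℝ) :
    ∑ b, h b * ∑ a ∈ s with φ a = b, c a = ∑ a ∈ s, h (φ a) * c a := by
  simp only [Finset.mul_sum, Finset.sum_filter, mul_ite, mul_zero]
  rw [Finset.sum_comm]
  simp

namespace Instance

/-- If an edge vector of the preprocessed complete graph satisfies the cut constraints of all cuts
that contain an odd number of edges of `C`, then it costs at least as much as some join of the
odd-degree vertices of the restoration of `C`. -/
theorem exists_isJoin_odd_restore_le {V : Type*} [Finite V] (I : Instance V)
    {P : Sym2 I.HatV → Multiset (Sym2 I.HatV)} (hP : I.IsShortestPathSystem P)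
    (C : (⊤ : SimpleGraph I.HatV).Subgraph) {c : Sym2 I.HatV → ℝ}
    (hc : ∀ f ∈ (⊤ : SimpleGraph I.HatV).edgeSet, 0 ≤ c f)
    (hcut : ∀ (S : Set I.HatV) (F : Finset (Sym2 I.HatV)),
      (∀ f, f ∈ F ↔ f ∈ C.edgeSet ∧ f ∈ cut S) → Odd F.card → 1 ≤ total c (cut S)) :
    ∃ J, IsJoin I.graph (odd (I.restore P C)) J ∧ multiLength I.length J ≤
      total (fun f => I.hatLength f * c f) (⊤ : SimpleGraph I.HatV).edgeSet := by
  classical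
  have : Fintype V := Fintype.ofFinite V
  choose m hm using exists_isMinJoin_endSet I.connected I.length_nonneg
  set A : Finset (Sym2 I.HatV) := (⊤ : SimpleGraph I.HatV).edgeSet.toFinite.toFinset with hA
  have hcA : ∀ f ∈ A, 0 ≤ c f := fun f hf => hc f (by simpa [hA] using hf)
  -- The vector `c` is pushed forward along the merging of copies. Its cut at `S` is then the cut of
  -- `c` at the preimage of `S`, and the parity equivalence makes `hcut` applicable.
  obtain ⟨J, hJ, hle⟩ := exists_isJoin_le I.length_nonneg hm
    (Q := Finset.univ.filter fun v => v ∈ odd (I.restore P C))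
    (z := fun e => ∑ f ∈ A with f.map I.merge = e, c f)
    (fun e => Finset.sum_nonneg fun f hf => hcA f (Finset.mem_filter.1 hf).1) fun S hS => by
      have h1 : S ∩ (Finset.univ.filter fun v => v ∈ odd (I.restore P C)) =
          S.filter fun v => v ∈ odd (I.restore P C) := by
        ext v
        simp
      rw [h1, I.odd_card_inter_odd_restore_iff hP] at hS
      refine (hcut (I.merge ⁻¹' (S : Set V)) _ (fun f => by simp) hS).trans (le_of_eq ?_)
      have h2 : ∀ e : Sym2 V, ¬ (fstEnd e ∈ S ↔ sndEnd e ∈ S) ↔ e ∈ cut (S : Set V) := fun e => by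
        conv_rhs => rw [← mk_ends e, mk_mem_cut]
        simp only [Finset.mem_coe]
      have h3 := sum_mul_fiberwise A (Sym2.map I.merge) c
        (fun e => if e ∈ cut (S : Set V) then 1 else 0)
      have h4 : pairCut (fun e => ∑ f ∈ A with f.map I.merge = e, c f) S =
          ∑ e, (if e ∈ cut (S : Set V) then 1 else 0) *
            ∑ f ∈ A with f.map I.merge = e, c f := by
        unfold pairCut cutSum
        refine Finset.sum_congr rfl fun e _ => ?_
        rw [← ite_not]
        simp only [h2, ite_mul, one_mul, zero_mul]
      rw [h4, h3]
      simp only [ite_mul, one_mul, zero_mul, map_merge_mem_cut_iff]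
      rw [← Finset.sum_filter, total]
      refine Finset.sum_congr ?_ fun _ _ => rfl
      ext f
      simp only [Set.Finite.mem_toFinset, Finset.mem_filter, hA]
      exact ⟨fun h => ⟨cut_subset_edgeSet _ h, h⟩, fun h => h.2⟩
  refine ⟨J, by simpa using hJ, hle.trans ?_⟩
  rw [sum_mul_fiberwise, total]
  refine Finset.sum_le_sum fun f hf => mul_le_mul_of_nonneg_right ?_ (hcA f hf)
  -- The restoration of `f` is one join of its merged ends and has length `ŵ_f`, so the minimum join
  -- used as the cost of the merged pair is no longer.
  obtain ⟨h1, h2⟩ := I.isJoin_restoreEdge hP (f := f) (by simpa [hA] using hf)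
  rw [← h2]
  exact (hm _).2 _ h1

end Instance

end PCRPP

theorem mainTheorem6 {V : Type*} [Finite V] (I : PCRPP.Instance V)
    -- an optimal solution `(x*, y*)` of the relaxation, a threshold `δ`, and the pair `(x, y)`
    -- obtained from it by the complete splittings for `δ`
    (xStar : Sym2 I.HatV → ℝ) (yStar : I.HatV → ℝ) (hopt : I.IsLPOptimal xStar yStar)
    (δ : ℝ) (hδ : δ ∈ Set.Icc (0 : ℝ) 1)
    (x : Sym2 I.HatV → ℝ) (y : I.HatV → ℝ)
    (hsplit : PCRPP.SplittingResult I.hatRoot δ (xStar, yStar) (x, y))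
    -- a tree `T` in the support of a tree decomposition of `(x, y)`
    (𝒯 : Finset (⊤ : SimpleGraph I.HatV).Subgraph) (lam : (⊤ : SimpleGraph I.HatV).Subgraph → ℝ)
    (hdec : PCRPP.IsTreeDecomposition I.hatRoot I.hatPos x y 𝒯 lam)
    (T : (⊤ : SimpleGraph I.HatV).Subgraph) (hT : T ∈ 𝒯) (hlam : 0 < lam T)
    (γ : ℝ) (hγ : γ ∈ Set.Icc (0 : ℝ) 1)
    (q : ℕ) (η : ℕ → ℝ) (hη : PCRPP.EnumeratesPositiveValues I.hatPos x q η)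
    -- the shortest paths used in the restoration
    (P : Sym2 I.HatV → Multiset (Sym2 I.HatV)) (hP : I.IsShortestPathSystem P)
    -- the restored multigraph
    (H : Multiset (Sym2 V)) (hH : H = I.restore P (PCRPP.core I.hatRoot I.hatPos x T γ)) :
    (∃ J, PCRPP.IsMinJoin I.graph I.length (PCRPP.odd H) J) ∧
    ∀ J, PCRPP.IsMinJoin I.graph I.length (PCRPP.odd H) J →
      PCRPP.multiLength I.length J ≤
        1 / (3 - δ) * PCRPP.total (fun e => I.hatLength e * x e) (⊤ : SimpleGraph I.HatV).edgeSet +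
        ∑ i ∈ Finset.Icc 1 q with γ ≤ η i, (1 - 2 * η i / (3 - δ)) *
          PCRPP.total I.hatLength ((PCRPP.coreSeq I.hatRoot I.hatPos x T η i).edgeSet \
            (PCRPP.coreSeq I.hatRoot I.hatPos x T η (i - 1)).edgeSet) := by
  subst hH
  have hxy : PCRPP.CutFeasible I.hatRoot x y := hsplit.cutFeasible hopt.1.cutFeasible
  obtain ⟨J, hJ, hle⟩ := I.exists_isJoin_odd_restore_le hP (PCRPP.core I.hatRoot I.hatPos x T γ)
    (c := PCRPP.correction I.hatRoot I.hatPos x T δ γ q η)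
    (fun f hf => add_nonneg
      (mul_nonneg (one_div_nonneg.2 (by linarith [hδ.2])) (hxy.1 f hf))
      (PCRPP.layerWeight_nonneg hη (fun e he => hdec.edge_le_one he) hδ f))
    fun S F hF hodd => PCRPP.one_le_total_correction hxy hδ hsplit.2 hdec hT hlam hη hF hodd
  rw [PCRPP.total_mul_correction] at hle
  exact ⟨PCRPP.exists_isMinJoin I.length_nonneg ⟨J, hJ⟩, fun J' hJ' => (hJ'.2 J hJ).trans hle⟩
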